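/- Let $k$ be a commutative Noetherian ring and $G$ a finite group. Let $\mathrm{FI}_G$ be the category whose objects are the sets $[n]=\{1,\dots,n\}$, $n\geq 0$, and whose morphisms $[n]\to[m]$ are pairs $(f,g)$ of an injection $f:[n]\to[m]$ and a map $g:[n]\to G$, with $(f,g)\circ(f',g')=(f\circ f',h)$, $h(x)=g'(x)\,g(f'(x))$. Put $G_n=\mathrm{End}([n])$ (the wreath product $G\wr\mathfrak S_n$). An $\mathrm{FI}_G$-module is a functor $V$ from $\mathrm{FI}_G$ to $k$-modules, with $V_n=V([n])$; these form an abelian category, in which $\mathrm{Ext}$ is taken. Let $\iota:\mathrm{FI}_G\to\mathrm{FI}_G$ be the self-embedding $[n]\mapsto[n+1]$, $(f,g)\mapsto(f_+,g_+)$, where $f_+,g_+$ extend $f,g$ (for $f:[n]\to[m]$) by $f_+(n+1)=m+1$, $g_+(n+1)=1$; it embeds $G_n$ into $G_{n+1}$. For a $kG_n$-module $W$ let $M(W)$ be the $\mathrm{FI}_G$-module $M(W)_m=k[\mathrm{Hom}([n],[m])]\otimes_{kG_n}W$, and let $M(n)=M(kG_n)$, that is, $M(n)_m=k[\mathrm{Hom}([n],[m])]$.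 A module $V$ is $\sharp$-filtered if it has a finite filtration $0=V^{(-1)}\subseteq V^{(0)}\subseteq\cdots\subseteq V^{(N)}=V$ such that, for every $i$, $V^{(i)}/V^{(i-1)}\cong M(W^{(i)})$ for some $kG_i$-module $W^{(i)}$. Define functors on $\mathrm{FI}_G$-modules as follows: the shift $\Sigma V=V\circ\iota$; the coinduction $R(V)_n=\mathrm{Hom}(\Sigma M(n),V)$, on which a morphism $q:[n]\to[m]$ acts by $(q\varphi)(p)=\varphi(p\circ q)$; and the induction $L(V)_m=\bigoplus_n k[\mathrm{Hom}([n+1],[m])]\otimes_k V_n$ modulo the relations $(p\circ\iota(q))\otimes v=p\otimes q v$ (that is, $L(V)=k\mathrm{FI}_{G,+}\otimes_{k\mathrm{FI}_G}V$, where $k\mathrm{FI}_{G,+}$ is the category algebra of the full subcategory on the objects $[n]$ with $n>0$). Then: 0. $L$ is left adjoint to $\Sigma$, and $R$ is right adjoint to $\Sigma$. 1. The functors $\Sigma$, $L$ and $R$ are exact. 2. If $V$ is $\sharp$-filtered, then so are $\Sigma V$, $L(V)$ and $R(V)$. More explicitly, for every $n\geq 0$ and every $kG_n$-module $W$ (in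 particular every finitely generated one), $$R(M(W))\cong M(W)\oplus M(\mathrm{Ind}_{G_n}^{G_{n+1}}W),\qquad L(M(W))\cong M(\mathrm{Ind}_{G_n}^{G_{n+1}}W),$$ and $\Sigma M(W)\cong M(W)\oplus M(\mathrm{Res}^{G_n}_{G_{n-1}}W)$ if $n\geq 1$, while $\Sigma M(W)\cong M(W)$ if $n=0$. 3. For all $\mathrm{FI}_G$-modules $V$ and $V'$ (in particular for finitely generated ones) and all $i\geq 0$ there are isomorphisms of $k$-modules $$\mathrm{Ext}^i(L(V),V')\cong\mathrm{Ext}^i(V,\Sigma V'),\qquad \mathrm{Ext}^i(\Sigma V,V')\cong\mathrm{Ext}^i(V,R(V')).$$ -/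

import Mathlib

open CategoryTheory CategoryTheory.Limits
open scoped DirectSum

universe u

noncomputable section

/-! ## The category `FI_G` -/

/-- The objects of `FI_G`: the finite sets `[n]`, one for every natural number `n`.
The set `[n]` is modelled by `Fin n`. -/
structure FIG (G : Type u) where
  n : ℕ

namespace FIG

variable {G : Type u}

/-- A morphism `[n] ⟶ [m]` of `FI_G`: an injection together with a map of sets `[n] → G`. -/
@[ext]
structure Hom (X Y : FIG G) where
  inj : Fin X.n ↪ Fin Y.n
  lab : Fin X.n → G

variable [Group G]

/-- `(f, g) ∘ (f', g') = (f ∘ f', h)` with `h x = g' x * g (f' x)`; here `p ≫ q` is `q ∘ p`. -/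
instance : Category.{u} (FIG G) where
  Hom X Y := Hom X Y
  id X := ⟨Function.Embedding.refl _, fun _ => 1⟩
  comp p q := ⟨p.inj.trans q.inj, fun x => p.lab x * q.lab (p.inj x)⟩
  id_comp p := by ext x <;> simp
  comp_id p := by ext x <;> simp
  assoc p q r := by ext x <;> simp [mul_assoc]

@[ext]
theorem hom_ext {X Y : FIG G} {p q : X ⟶ Y} (h₁ : ∀ x, p.inj x = q.inj x)
    (h₂ : ∀ x, p.lab x = q.lab x) : p = q :=
  Hom.ext (Function.Embedding.ext h₁) (funext h₂)

@[simp] theorem id_inj (X : FIG G) (x : Fin X.n) : (𝟙 X : X ⟶ X).inj x = x := rfl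
@[simp] theorem id_lab (X : FIG G) (x : Fin X.n) : (𝟙 X : X ⟶ X).lab x = 1 := rfl
@[simp] theorem comp_inj {X Y Z : FIG G} (p : X ⟶ Y) (q : Y ⟶ Z) (x : Fin X.n) :
    (p ≫ q).inj x = q.inj (p.inj x) := rfl
@[simp] theorem comp_lab {X Y Z : FIG G} (p : X ⟶ Y) (q : Y ⟶ Z) (x : Fin X.n) :
    (p ≫ q).lab x = p.lab x * q.lab (p.inj x) := rfl

/-- The permutation underlying an endomorphism. -/
def endPerm {X : FIG G} (p : End X) : Equiv.Perm (Fin X.n) :=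
  Equiv.ofBijective (Hom.inj p) (Finite.injective_iff_bijective.mp (Hom.inj p).injective)

theorem endPerm_symm_inj {X : FIG G} (p : End X) (x : Fin X.n) :
    (endPerm p).symm (Hom.inj p x) = x :=
  (endPerm p).symm_apply_apply x

/-- The endomorphisms of `[n]` form a group (the wreath product of `G` and the symmetric group).
The multiplication is composition, `p * q = p ∘ q`. -/
instance (X : FIG G) : Group (End X) :=
  { (inferInstance : Monoid (End X)) with
    inv := fun p =>
      (⟨(endPerm p).symm.toEmbedding, fun y => (Hom.lab p ((endPerm p).symm y))⁻¹⟩ : Hom X X)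
    inv_mul_cancel := fun p => by
      refine FIG.hom_ext (fun x => ?_) (fun x => ?_)
      · exact endPerm_symm_inj p x
      · change Hom.lab p x * (Hom.lab p ((endPerm p).symm (Hom.inj p x)))⁻¹ = 1
        rw [endPerm_symm_inj, mul_inv_cancel] }

/-- On morphisms, `(f, g) ↦ (f₊, g₊)`: the last element is sent to the last element,
with label `1`. -/
def plusHom {X Y : FIG G} (p : X ⟶ Y) : (⟨X.n + 1⟩ : FIG G) ⟶ ⟨Y.n + 1⟩ :=
  (⟨⟨Fin.lastCases (Fin.last Y.n) (fun x => (p.inj x).castSucc), by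
      intro a b
      refine Fin.lastCases ?_ (fun a => ?_) a <;> refine Fin.lastCases ?_ (fun b => ?_) b <;>
        simp [Fin.castSucc_ne_last, (Fin.castSucc_ne_last _).symm]⟩,
    Fin.lastCases 1 (fun x => p.lab x)⟩ : Hom _ _)

@[simp] theorem plusHom_inj_last {X Y : FIG G} (p : X ⟶ Y) :
    (plusHom p).inj (Fin.last X.n) = Fin.last Y.n :=
  Fin.lastCases_last (motive := fun _ => Fin (Y.n + 1)) (cast := fun x => (p.inj x).castSucc)
@[simp] theorem plusHom_inj_castSucc {X Y : FIG G} (p : X ⟶ Y) (x : Fin X.n) :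
    (plusHom p).inj x.castSucc = (p.inj x).castSucc :=
  Fin.lastCases_castSucc (motive := fun _ => Fin (Y.n + 1)) (cast := fun x => (p.inj x).castSucc) x
@[simp] theorem plusHom_lab_last {X Y : FIG G} (p : X ⟶ Y) :
    (plusHom p).lab (Fin.last X.n) = 1 :=
  Fin.lastCases_last (motive := fun _ => G) (cast := fun x => p.lab x)
@[simp] theorem plusHom_lab_castSucc {X Y : FIG G} (p : X ⟶ Y) (x : Fin X.n) :
    (plusHom p).lab x.castSucc = p.lab x :=
  Fin.lastCases_castSucc (motive := fun _ => G) (cast := fun x => p.lab x) x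

theorem plusHom_id (X : FIG G) : plusHom (𝟙 X) = 𝟙 (⟨X.n + 1⟩ : FIG G) := by
  refine FIG.hom_ext (fun x => ?_) (fun x => ?_) <;> refine Fin.lastCases ?_ (fun x => ?_) x
  · rw [plusHom_inj_last, id_inj]
  · rw [plusHom_inj_castSucc, id_inj, id_inj]
  · rw [plusHom_lab_last, id_lab]
  · rw [plusHom_lab_castSucc, id_lab, id_lab]

theorem plusHom_comp {X Y Z : FIG G} (p : X ⟶ Y) (q : Y ⟶ Z) :
    plusHom (p ≫ q) = plusHom p ≫ plusHom q := by
  refine FIG.hom_ext (fun x => ?_) (fun x => ?_) <;> refine Fin.lastCases ?_ (fun x => ?_) x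
  · rw [plusHom_inj_last, comp_inj, plusHom_inj_last, plusHom_inj_last]
  · rw [plusHom_inj_castSucc, comp_inj, comp_inj, plusHom_inj_castSucc, plusHom_inj_castSucc]
  · rw [plusHom_lab_last, comp_lab, plusHom_inj_last, plusHom_lab_last, plusHom_lab_last, one_mul]
  · rw [plusHom_lab_castSucc, comp_lab, comp_lab, plusHom_inj_castSucc, plusHom_lab_castSucc,
      plusHom_lab_castSucc]

variable (G) in
/-- The self-embedding functor `ι : FI_G ⥤ FI_G`, `[n] ↦ [n+1]`. -/
def plus : FIG G ⥤ FIG G where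
  obj X := ⟨X.n + 1⟩
  map p := plusHom p
  map_id X := plusHom_id X
  map_comp p q := plusHom_comp p q

variable (G) in
/-- The group `G_n = End([n])`. -/
abbrev Grp (n : ℕ) : Type u := End (⟨n⟩ : FIG G)

variable (G) in
/-- The embedding of groups `G_n → G_{n+1}` given by the self-embedding of `FI_G`. -/
def grpPlus (n : ℕ) : Grp G n →* Grp G (n + 1) := (plus G).mapEnd ⟨n⟩

end FIG

/-! ## `FI_G`-modules -/

/-- The category of `FI_G`-modules over `k`. -/
abbrev FIGMod (k G : Type u) [CommRing k] [Group G] : Type (u + 1) := FIG G ⥤ ModuleCat.{u} k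

instance (k G : Type u) [CommRing k] [Group G] : HasExt.{u + 1} (FIGMod k G) :=
  HasExt.standard _

namespace FIGMod

variable {k G : Type u} [CommRing k] [Group G]

/-! ### Basic filtered modules -/

/-- `k[Hom([n],[m])] ⊗_k W`, that is, the direct sum of copies of `W` indexed by `Hom([n],[m])`.
The element `p ⊗ w` is `Finsupp.single p w`. -/
abbrev BasicPre (n : ℕ) (W : Rep.{u} k (FIG.Grp G n)) (Y : FIG G) : Type u :=
  ((⟨n⟩ : FIG G) ⟶ Y) →₀ W

/-- The relations `(p ∘ s) ⊗ w = p ⊗ (s • w)`, for `s` in `G_n`, in `k[Hom([n],[m])] ⊗ W`. -/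
def basicRel (n : ℕ) (W : Rep.{u} k (FIG.Grp G n)) (Y : FIG G) : Submodule k (BasicPre n W Y) :=
  Submodule.span k {t | ∃ (p : (⟨n⟩ : FIG G) ⟶ Y) (s : FIG.Grp G n) (w : W),
    t = Finsupp.single (s ≫ p) w - Finsupp.single p (W.ρ s w)}

/-- The map on `k[Hom([n],[m])] ⊗ W` given by composition with `q` on the first factor. -/
def basicMap (n : ℕ) (W : Rep.{u} k (FIG.Grp G n)) {Y Z : FIG G} (q : Y ⟶ Z) :
    BasicPre n W Y →ₗ[k] BasicPre n W Z :=
  Finsupp.lmapDomain W k (fun p : (⟨n⟩ : FIG G) ⟶ Y => p ≫ q)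

theorem basicMap_single (n : ℕ) (W : Rep.{u} k (FIG.Grp G n)) {Y Z : FIG G} (q : Y ⟶ Z)
    (p : (⟨n⟩ : FIG G) ⟶ Y) (w : W) :
    basicMap n W q (Finsupp.single p w) = Finsupp.single (p ≫ q) w := by
  simp [basicMap]

theorem basicRel_le (n : ℕ) (W : Rep.{u} k (FIG.Grp G n)) {Y Z : FIG G} (q : Y ⟶ Z) :
    basicRel n W Y ≤ (basicRel n W Z).comap (basicMap n W q) := by
  refine Submodule.span_le.mpr ?_
  rintro _ ⟨p, s, w, rfl⟩
  refine Submodule.subset_span ⟨p ≫ q, s, w, ?_⟩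
  rw [map_sub, basicMap_single, basicMap_single, Category.assoc]

/-- The basic filtered module `M(W)`, `M(W)_m = k[Hom([n],[m])] ⊗_{k G_n} W`, for a
`k G_n`-module `W`. -/
def basic (n : ℕ) (W : Rep.{u} k (FIG.Grp G n)) : FIGMod k G where
  obj Y := ModuleCat.of k (BasicPre n W Y ⧸ basicRel n W Y)
  map q := ModuleCat.ofHom (Submodule.mapQ _ _ (basicMap n W q) (basicRel_le n W q))
  map_id Y := by
    ext : 1
    refine Submodule.linearMap_qext _ (Finsupp.lhom_ext fun p w => ?_)
    simp [basicMap_single]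
  map_comp q r := by
    ext : 1
    refine Submodule.linearMap_qext _ (Finsupp.lhom_ext fun p w => ?_)
    simp [basicMap_single]

/-- A `♯`-filtered module: there is a finite filtration
`0 = F 0 ⊆ F 1 ⊆ ⋯ ⊆ F (N + 1) = V` such that `F (i + 1) / F i ≅ M(W)` for some
`k G_i`-module `W`, for every `i ≤ N`. -/
def IsSharpFiltered (V : FIGMod k G) : Prop :=
  ∃ (N : ℕ) (F : ℕ → Subobject V), F 0 = ⊥ ∧ F (N + 1) = ⊤ ∧
    ∀ i ≤ N, ∃ (h : F i ≤ F (i + 1)) (W : Rep.{u} k (FIG.Grp G i)),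
      Nonempty (cokernel (Subobject.ofLE (F i) (F (i + 1)) h) ≅ basic i W)

/-! ### Shift, coinduction and induction -/

variable (k G) in
/-- The shift functor `Σ V = V ∘ ι`. -/
def shift : FIGMod k G ⥤ FIGMod k G :=
  (Functor.whiskeringLeft _ _ _).obj (FIG.plus G)

variable (k) in
/-- The free module `M(n) = k[Hom([n], -)]`. -/
def free (X : FIG G) : FIGMod k G := coyoneda.obj (Opposite.op X) ⋙ ModuleCat.free k

variable (k) in
/-- The map `M(m) ⟶ M(n)` given by composition on the right with `q : [n] ⟶ [m]`. -/
def freeMap {X Y : FIG G} (q : X ⟶ Y) : free k Y ⟶ free k X :=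
  Functor.whiskerRight (coyoneda.map q.op) (ModuleCat.free k)

theorem freeMap_id (X : FIG G) : freeMap k (𝟙 X) = 𝟙 (free k X) := by
  simp [freeMap, free]

theorem freeMap_comp {X Y Z : FIG G} (q : X ⟶ Y) (r : Y ⟶ Z) :
    freeMap k (q ≫ r) = freeMap k r ≫ freeMap k q := by
  simp [freeMap, free]

/-- Coinduction on objects: `R(V)_n = Hom(Σ M(n), V)`, where a morphism `q : [n] ⟶ [m]` acts by
`(q φ)(p) = φ(p ∘ q)`. -/
def coindObj (V : FIGMod k G) : FIGMod k G where
  obj X := ModuleCat.of k ((shift k G).obj (free k X) ⟶ V)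
  map q := ModuleCat.ofHom (Linear.leftComp k V ((shift k G).map (freeMap k q)))
  map_id X := by
    ext : 1
    refine LinearMap.ext fun φ => ?_
    simp [freeMap_id]
  map_comp q r := by
    ext : 1
    refine LinearMap.ext fun φ => ?_
    simp [freeMap_comp]

variable (k G) in
/-- The coinduction functor `R`. -/
def coind : FIGMod k G ⥤ FIGMod k G where
  obj V := coindObj V
  map α :=
    { app := fun X => ModuleCat.ofHom (Linear.rightComp k ((shift k G).obj (free k X)) α)
      naturality := fun X Y q => by
        ext : 1
        refine LinearMap.ext fun φ => ?_
        exact Category.assoc ((shift k G).map (freeMap k q)) φ α }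
  map_id V := by
    ext X : 3
    refine LinearMap.ext fun φ => ?_
    exact Category.comp_id (X := (shift k G).obj (free k X)) φ
  map_comp α β := by
    ext X : 3
    refine LinearMap.ext fun φ => ?_
    exact (Category.assoc (W := (shift k G).obj (free k X)) φ α β).symm

/-- `⨁_n k[Hom([n+1],[m])] ⊗_k V_n`, where each `k[Hom([n+1],[m])] ⊗_k V_n` is again a direct sum of
copies of `V_n`. The first factors make up the degree `m` part of the bimodule `k FI_{G,+}`, on
which `k FI_G` acts on the right via the self-embedding. -/
abbrev IndPre (V : FIGMod k G) (Y : FIG G) : Type u :=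
  ⨁ X : FIG G, (((FIG.plus G).obj X ⟶ Y) →₀ V.obj X)

instance : DecidableEq (FIG G) := Classical.decEq _

/-- The element `p ⊗ v`. -/
def indTmul (V : FIGMod k G) {X Y : FIG G} (p : (FIG.plus G).obj X ⟶ Y) (v : V.obj X) :
    IndPre V Y :=
  DirectSum.lof k (FIG G) (fun X => ((FIG.plus G).obj X ⟶ Y) →₀ V.obj X) X (Finsupp.single p v)

/-- The relations `(p ∘ ι(q)) ⊗ v = p ⊗ q v` of the tensor product over `k FI_G`. -/
def indRel (V : FIGMod k G) (Y : FIG G) : Submodule k (IndPre V Y) :=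
  Submodule.span k {t | ∃ (X X' : FIG G) (q : X ⟶ X') (p : (FIG.plus G).obj X' ⟶ Y) (v : V.obj X),
    t = indTmul V ((FIG.plus G).map q ≫ p) v - indTmul V p ((V.map q).hom v)}

/-- Composition with `r` on the first factors. -/
def indPreMap (V : FIGMod k G) {Y Z : FIG G} (r : Y ⟶ Z) : IndPre V Y →ₗ[k] IndPre V Z :=
  DirectSum.lmap fun X =>
    Finsupp.lmapDomain (V.obj X) k (fun p : (FIG.plus G).obj X ⟶ Y => p ≫ r)

/-- A map of `FI_G`-modules applied to the second factors. -/
def indPreMap₂ {V V' : FIGMod k G} (α : V ⟶ V') (Y : FIG G) : IndPre V Y →ₗ[k] IndPre V' Y :=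
  DirectSum.lmap fun X => Finsupp.mapRange.linearMap (α.app X).hom

theorem indPreMap_tmul (V : FIGMod k G) {X Y Z : FIG G} (r : Y ⟶ Z)
    (p : (FIG.plus G).obj X ⟶ Y) (v : V.obj X) :
    indPreMap V r (indTmul V p v) = indTmul V (p ≫ r) v := by
  simp [indPreMap, indTmul, DirectSum.lmap_lof]

theorem indPreMap₂_tmul {V V' : FIGMod k G} (α : V ⟶ V') {X Y : FIG G}
    (p : (FIG.plus G).obj X ⟶ Y) (v : V.obj X) :
    indPreMap₂ α Y (indTmul V p v) = indTmul V' p ((α.app X).hom v) := by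
  simp [indPreMap₂, indTmul, DirectSum.lmap_lof]

theorem indRel_le (V : FIGMod k G) {Y Z : FIG G} (r : Y ⟶ Z) :
    indRel V Y ≤ (indRel V Z).comap (indPreMap V r) := by
  refine Submodule.span_le.mpr ?_
  rintro _ ⟨X, X', q, p, v, rfl⟩
  refine Submodule.subset_span ⟨X, X', q, p ≫ r, v, ?_⟩
  rw [map_sub, indPreMap_tmul, indPreMap_tmul, Category.assoc]

theorem indRel_le₂ {V V' : FIGMod k G} (α : V ⟶ V') (Y : FIG G) :
    indRel V Y ≤ (indRel V' Y).comap (indPreMap₂ α Y) := by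
  refine Submodule.span_le.mpr ?_
  rintro _ ⟨X, X', q, p, v, rfl⟩
  refine Submodule.subset_span ⟨X, X', q, p, (α.app X).hom v, ?_⟩
  rw [map_sub, indPreMap₂_tmul, indPreMap₂_tmul]
  congr 2
  exact congrArg (fun f => f.hom v) (α.naturality q)

/-- Linear maps out of the tensor product are determined on the elements `p ⊗ v`. -/
theorem ind_hom_ext {V : FIGMod k G} {Y : FIG G} {A : Type*} [AddCommGroup A] [Module k A]
    {f g : (IndPre V Y ⧸ indRel V Y) →ₗ[k] A}
    (h : ∀ (X : FIG G) (p : (FIG.plus G).obj X ⟶ Y) (v : V.obj X),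
      f ((indRel V Y).mkQ (indTmul V p v)) = g ((indRel V Y).mkQ (indTmul V p v))) : f = g := by
  refine Submodule.linearMap_qext _ (DirectSum.linearMap_ext k fun X =>
    Finsupp.lhom_ext fun p v => ?_)
  exact h X p v

/-- Induction on objects: `L(V) = k FI_{G,+} ⊗_{k FI_G} V`. -/
def indObj (V : FIGMod k G) : FIGMod k G where
  obj Y := ModuleCat.of k (IndPre V Y ⧸ indRel V Y)
  map r := ModuleCat.ofHom (Submodule.mapQ _ _ (indPreMap V r) (indRel_le V r))
  map_id Y := by
    ext : 1
    refine ind_hom_ext fun X p v => ?_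
    simp [indPreMap_tmul]
  map_comp q r := by
    ext : 1
    refine ind_hom_ext fun X p v => ?_
    simp [indPreMap_tmul]

variable (k G) in
/-- The induction functor `L`. -/
def ind : FIGMod k G ⥤ FIGMod k G where
  obj V := indObj V
  map α :=
    { app := fun Y => ModuleCat.ofHom
        (Submodule.mapQ _ _ (indPreMap₂ α Y) (indRel_le₂ α Y))
      naturality := fun Y Z r => by
        ext : 1
        refine ind_hom_ext fun X p v => congrArg (indRel _ Z).mkQ ?_
        rw [indPreMap_tmul, indPreMap₂_tmul, indPreMap₂_tmul, indPreMap_tmul] }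
  map_id V := by
    ext Y : 3
    refine ind_hom_ext fun X p v => congrArg (indRel V Y).mkQ ?_
    exact indPreMap₂_tmul (𝟙 V) p v
  map_comp α β := by
    ext Y : 3
    refine ind_hom_ext fun X p v => congrArg (indRel _ Y).mkQ ?_
    rw [indPreMap₂_tmul, indPreMap₂_tmul, indPreMap₂_tmul]
    rfl

end FIGMod

end

/-!
The whole theorem rests on how a morphism of `FI_G` meets the last element. A morphism
`[n] ⟶ [m+1]` either avoids the last element, and then factors uniquely through the standard
inclusion `[m] ⟶ [m+1]`, or hits it, and then becomes of the form `ι(q)` after an automorphism of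
its source. Dually, every morphism `[n+1] ⟶ [m+1]` is `ι(q)` followed by an automorphism of its
target which depends only on the image and the label of the last element. Hence `L(V)_{m+1}` is a
direct sum of copies of `V_m` indexed by `[m+1] × G`, and `L(V)_0 = 0`.

*Adjunctions.* By the Yoneda lemma an element of `R(V)_n` is a family of elements of the `V_m`,
indexed by the morphisms `[n] ⟶ [m+1]` and natural in `[m]`. Both adjunctions are then written down
by formulas on the elements `p ⊗ v` of `L(V)` and on such families.

*Exactness.* The shift is a precomposition, hence exact, so that each of `L` and `R` is exact on one
side. The description of `L(V)_{m+1}` shows that `L` preserves injections. There is a natural map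
`L(V) ⟶ R(V)`, which sends `p ⊗ v` to the family whose member at `r` is `q v` if `r ∘ p = ι(q)` and
zero if there is no such `q`. As `G` is finite, it fits into a short exact sequence
`0 ⟶ L(V) ⟶ R(V) ⟶ V ⟶ 0` (`indCoindComplex_shortExact`), and a diagram chase along it shows that
`R` preserves surjections.

*Basic filtered modules.* `W ↦ M(W)` is left adjoint to the evaluation `V ↦ V_n`. Therefore `L ∘ M`
and `M ∘ Ind` are both left adjoint to `V ↦ Res V_{n+1}`, and so `L(M(W)) ≅ M(Ind W)`
(`indBasicIso`). The inclusion `M(W) ⟶ Σ M(W)` has a retraction, which kills `p ⊗ w` if `p` hits the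
last element; its kernel is `M(Res W)` in positive degree (`shiftBasicSuccIso`) and zero in degree
zero. By the adjunction the same retraction
gives a section of `R(M(W)) ⟶ M(W)`, so that the sequence above splits (`coindBasicIso`).

*Filtrations.* By exactness the three functors carry a filtration of `V` with quotients `M(W)` to
one whose quotients are values on the `M(W)`. For `L` these quotients have the required form. For
`Σ` and `R` they are sums of basic filtered modules of two adjacent degrees, so that every degree
occurs in two consecutive quotients. The filtration is repaired by the fact that an extension of two
basic filtered modules of the same degree is again one (`IsBasic.of_shortExact`): the functor
`W ↦ M(W)` is fully faithful, and the modules in its essential image are those at which the counit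
`M(V_n) ⟶ V` is an isomorphism, to which the five lemma applies.

*Extension groups.* An adjunction between exact functors induces one between the derived categories,
and `Ext` is a group of morphisms there (`nonempty_ext_linearEquiv`).
-/

noncomputable section

/-! ### Adjunctions between exact functors and extension groups -/

namespace CategoryTheory.Adjunction

universe w w' v v' u'
variable {C : Type u} [Category.{v} C] [Abelian C] {D : Type u'} [Category.{v'} D] [Abelian D]

/-- An adjunction between additive functors, applied degreewise to complexes. -/
def mapHomologicalComplex {F : C ⥤ D} {G : D ⥤ C} [F.Additive] [G.Additive] (adj : F ⊣ G)
    {ι : Type*} (c : ComplexShape ι) :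
    F.mapHomologicalComplex c ⊣ G.mapHomologicalComplex c where
  unit.app K :=
    { f := fun i => adj.unit.app (K.X i)
      comm' := fun i j _ => adj.unit_naturality (K.d i j) }
  unit.naturality _ _ f := by ext i; exact adj.unit_naturality (f.f i) |>.symm
  counit.app K :=
    { f := fun i => adj.counit.app (K.X i)
      comm' := fun i j _ => (adj.counit_naturality (K.d i j)).symm }
  counit.naturality _ _ f := by ext i; exact adj.counit_naturality (f.f i)
  left_triangle_components K := by ext i; exact adj.left_triangle_components (K.X i)
  right_triangle_components K := by ext i; exact adj.right_triangle_components (K.X i)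

variable {F : C ⥤ D} {G : D ⥤ C} [F.Additive] [G.Additive]
  [PreservesFiniteLimits F] [PreservesFiniteColimits F]
  [PreservesFiniteLimits G] [PreservesFiniteColimits G]

/-- An adjunction between exact functors induces one between the derived categories. -/
def mapDerivedCategory [HasDerivedCategory.{w} C] [HasDerivedCategory.{w'} D]
    (adj : F ⊣ G) : F.mapDerivedCategory ⊣ G.mapDerivedCategory :=
  letI : CatCommSq (F.mapHomologicalComplex (.up ℤ)) DerivedCategory.Q DerivedCategory.Q
    F.mapDerivedCategory := ⟨F.mapDerivedCategoryFactors.symm⟩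
  letI : CatCommSq (G.mapHomologicalComplex (.up ℤ)) DerivedCategory.Q DerivedCategory.Q
    G.mapDerivedCategory := ⟨G.mapDerivedCategoryFactors.symm⟩
  (adj.mapHomologicalComplex (.up ℤ)).localization
    DerivedCategory.Q (HomologicalComplex.quasiIso C (.up ℤ))
    DerivedCategory.Q (HomologicalComplex.quasiIso D (.up ℤ)) _ _

/-- The bijection of an adjunction on morphisms, as a linear map; only the right adjoint has to be
linear. -/
def homLinearEquiv {C D : Type*} [Category* C] [Category* D] [Preadditive C] [Preadditive D]
    (R : Type*) [Ring R] [Linear R C] [Linear R D] {F : C ⥤ D} {G : D ⥤ C} [G.Additive]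
    [G.Linear R] (adj : F ⊣ G) (X : C) (Y : D) :
    (F.obj X ⟶ Y) ≃ₗ[R] (X ⟶ G.obj Y) where
  __ := adj.homEquiv X Y
  map_add' f g := by simp [adj.homEquiv_unit]
  map_smul' r f := by simp [adj.homEquiv_unit]

attribute [local instance] HasDerivedCategory.standard in
/-- The Eckmann-Shapiro isomorphism: `Ext` in degree `n` is the module of morphisms to an `n`-fold
shift in the derived category, where the adjunction still holds. -/
theorem nonempty_ext_linearEquiv [HasExt.{w} C] [HasExt.{w'} D] (R : Type*) [CommRing R]
    [Linear R C] [Linear R D] [G.Linear R] (adj : F ⊣ G) (X : C) (Y : D) (n : ℕ) :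
    Nonempty (Abelian.Ext.{w'} (F.obj X) Y n ≃ₗ[R] Abelian.Ext.{w} X (G.obj Y) n) := by
  let e₁ := (F.mapDerivedCategorySingleFunctor 0).app X
  let e₂ := (G.mapDerivedCategory.commShiftIso (n : ℤ)).app
      ((DerivedCategory.singleFunctor D 0).obj Y) ≪≫
    (shiftFunctor _ (n : ℤ)).mapIso ((G.mapDerivedCategorySingleFunctor 0).app Y)
  exact ⟨Abelian.Ext.homLinearEquiv ≪≫ₗ Linear.homCongr R e₁.symm (Iso.refl _) ≪≫ₗ
    adj.mapDerivedCategory.homLinearEquiv R _ _ ≪≫ₗ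
    Linear.homCongr R (Iso.refl _) e₂ ≪≫ₗ Abelian.Ext.homLinearEquiv.symm⟩

end CategoryTheory.Adjunction

/-! ### Kernels, cokernels and subobjects in abelian categories -/

section Abelian

variable {𝒞 : Type*} [Category* 𝒞] [Abelian 𝒞]

/-- `0 ⟶ coker f ⟶ coker (f ≫ g) ⟶ coker g ⟶ 0` for a monomorphism `g`. -/
theorem shortExact_cokernel_comp {A B C : 𝒞} (f : A ⟶ B) (g : B ⟶ C) [Mono g] :
    (ShortComplex.mk (cokernel.map f (f ≫ g) (𝟙 _) g (by simp))
      (cokernel.map (f ≫ g) g f (𝟙 _) (by simp)) (by ext : 1; simp)).ShortExact where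
  exact := (kernelCokernelCompSequence_exact f g).exact 3
  mono_f := ((kernelCokernelCompSequence_exact f g).exact 2).mono_g
    ((isZero_kernel_of_mono g).eq_of_src _ _)
  epi_g := inferInstanceAs (Epi ((kernelCokernelCompSequence f g).map' 4 5))

/-- `0 ⟶ ker f ⟶ ker (f ≫ g) ⟶ ker g ⟶ 0` for an epimorphism `f`. -/
theorem shortExact_kernel_comp {A B C : 𝒞} (f : A ⟶ B) (g : B ⟶ C) [Epi f] :
    (ShortComplex.mk (kernel.map f (f ≫ g) (𝟙 _) g (by simp))
      (kernel.map (f ≫ g) g f (𝟙 _) (by simp)) (by ext : 1; simp)).ShortExact where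
  exact := (kernelCokernelCompSequence_exact f g).exact 0
  mono_f := inferInstanceAs (Mono ((kernelCokernelCompSequence f g).map' 0 1))
  epi_g := ((kernelCokernelCompSequence_exact f g).exact 1).epi_f
    ((isZero_cokernel_of_epi f).eq_of_tgt _ _)

theorem exists_cokernel_ofLE_mk_iso {A B V : 𝒞} (a : A ⟶ V) (b : B ⟶ V) [Mono a] [Mono b]
    (c : A ⟶ B) (w : c ≫ b = a) : ∃ h : Subobject.mk a ≤ Subobject.mk b,
      Nonempty (cokernel (Subobject.ofLE _ _ h) ≅ cokernel c) :=
  ⟨Subobject.mk_le_mk_of_comm c w,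
    ⟨cokernel.mapIso _ _ (Subobject.underlyingIso a) (Subobject.underlyingIso b) <| by
      simp [← cancel_mono b, w]⟩⟩

end Abelian

/-! ### Morphisms and the last element -/

namespace FIG

variable {G : Type u} [Group G]

/-- The last element of `[n+1]`. -/
def last (X : FIG G) : Fin ((plus G).obj X).n := Fin.last X.n

/-- The standard inclusion `[n] ⟶ [n+1]`, with trivial labels. -/
def incl (X : FIG G) : X ⟶ (plus G).obj X :=
  (⟨Fin.castSuccEmb, fun _ => 1⟩ : Hom X ⟨X.n + 1⟩)

theorem plus_map_inj_last {X Y : FIG G} (p : X ⟶ Y) :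
    ((plus G).map p).inj (last X) = last Y := plusHom_inj_last p
theorem plus_map_inj_castSucc {X Y : FIG G} (p : X ⟶ Y) (x : Fin X.n) :
    ((plus G).map p).inj x.castSucc = (p.inj x).castSucc := plusHom_inj_castSucc p x
theorem plus_map_lab_last {X Y : FIG G} (p : X ⟶ Y) :
    ((plus G).map p).lab (last X) = 1 := plusHom_lab_last p
theorem plus_map_lab_castSucc {X Y : FIG G} (p : X ⟶ Y) (x : Fin X.n) :
    ((plus G).map p).lab x.castSucc = p.lab x := plusHom_lab_castSucc p x

theorem incl_plus_map {X Y : FIG G} (p : X ⟶ Y) :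
    incl X ≫ (plus G).map p = p ≫ incl Y := by
  refine FIG.hom_ext (fun x => ?_) (fun x => ?_)
  · exact plusHom_inj_castSucc p x
  · exact (one_mul _).trans ((plusHom_lab_castSucc p x).trans (mul_one _).symm)

theorem comp_incl_injective {X Y : FIG G} :
    Function.Injective fun p : X ⟶ Y => p ≫ incl Y := by
  intro p q h
  refine FIG.hom_ext (fun x => ?_) (fun x => ?_)
  · exact Fin.castSucc_injective _ (congrArg (fun r : X ⟶ (plus G).obj Y => r.inj x) h)
  · have := congrArg (fun r : X ⟶ (plus G).obj Y => r.lab x) h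
    exact (mul_one _).symm.trans (this.trans (mul_one _))

theorem plus_map_injective {X Y : FIG G} :
    Function.Injective ((plus G).map : (X ⟶ Y) → ((plus G).obj X ⟶ (plus G).obj Y)) := by
  intro p q h
  refine comp_incl_injective ?_
  change p ≫ incl Y = q ≫ incl Y
  rw [← incl_plus_map, ← incl_plus_map, h]

/-- A morphism which avoids the last element factors through the standard inclusion. -/
theorem exists_comp_incl {X Y : FIG G} (p : X ⟶ (plus G).obj Y)
    (hp : ∀ x, p.inj x ≠ last Y) : ∃ q : X ⟶ Y, q ≫ incl Y = p := by
  refine ⟨(⟨⟨fun x => (p.inj x).castPred (hp x), fun a b h => ?_⟩, p.lab⟩ : Hom X Y), ?_⟩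
  · exact p.inj.injective (Fin.castPred_inj.mp h)
  · refine FIG.hom_ext (fun x => ?_) (fun x => ?_)
    · exact Fin.castSucc_castPred _ (hp x)
    · exact mul_one _

theorem comp_incl_inj_ne_last {X Y : FIG G} (q : X ⟶ Y) (x : Fin X.n) :
    (q ≫ incl Y).inj x ≠ last Y :=
  Fin.castSucc_ne_last _

/-- A morphism lies in the image of the self-embedding as soon as it sends the last element to
the last element, with label `1`. -/
theorem exists_plus_map {X Y : FIG G} (p : (plus G).obj X ⟶ (plus G).obj Y)
    (h₁ : p.inj (last X) = last Y) (h₂ : p.lab (last X) = 1) :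
    ∃ q : X ⟶ Y, (plus G).map q = p := by
  obtain ⟨q, hq⟩ := exists_comp_incl (incl X ≫ p) (fun x hx => by
    have h : p.inj x.castSucc = p.inj (last X) := hx.trans h₁.symm
    exact x.castSucc_ne_last (p.inj.injective h))
  refine ⟨q, FIG.hom_ext (Fin.lastCases ?_ fun x => ?_) (Fin.lastCases ?_ fun x => ?_)⟩
  · exact (plus_map_inj_last q).trans h₁.symm
  · refine (plus_map_inj_castSucc q x).trans ?_
    exact congrArg (fun r : X ⟶ (plus G).obj Y => r.inj x) hq
  · exact (plus_map_lab_last q).trans h₂.symm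
  · refine (plus_map_lab_castSucc q x).trans ?_
    have := congrArg (fun r : X ⟶ (plus G).obj Y => r.lab x) hq
    exact (mul_one _).symm.trans (this.trans (one_mul _))

-- The product `p * q` of endomorphisms is `q ≫ p`.
theorem comp_inv_self {X : FIG G} (a : End X) : (a : X ⟶ X) ≫ (a⁻¹ : End X) = 𝟙 X :=
  inv_mul_cancel a

theorem inv_comp_self {X : FIG G} (a : End X) : ((a⁻¹ : End X) : X ⟶ X) ≫ a = 𝟙 X :=
  mul_inv_cancel a

theorem comp_inv_self_assoc {X Y : FIG G} (a : End X) (p : X ⟶ Y) :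
    (a : X ⟶ X) ≫ ((a⁻¹ : End X) : X ⟶ X) ≫ p = p := by
  rw [← Category.assoc, comp_inv_self, Category.id_comp]

theorem inv_comp_self_assoc {X Y : FIG G} (a : End X) (p : X ⟶ Y) :
    ((a⁻¹ : End X) : X ⟶ X) ≫ (a : X ⟶ X) ≫ p = p := by
  rw [← Category.assoc, inv_comp_self, Category.id_comp]

/-- The automorphism of `[n+1]` which exchanges `i` with the last element, the label of the last
element being `g` and all other labels being trivial. -/
def swapLast (X : FIG G) (i : Fin ((plus G).obj X).n) (g : G) : End ((plus G).obj X) :=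
  (⟨(Equiv.swap i (last X)).toEmbedding, fun x => if x = last X then g else 1⟩ :
    Hom ((plus G).obj X) ((plus G).obj X))

theorem swapLast_inj_last (X : FIG G) (i : Fin ((plus G).obj X).n) (g : G) :
    Hom.inj (swapLast X i g) (last X) = i :=
  Equiv.swap_apply_right _ _

theorem swapLast_lab_last (X : FIG G) (i : Fin ((plus G).obj X).n) (g : G) :
    Hom.lab (swapLast X i g) (last X) = g :=
  if_pos rfl

/-- Every morphism `[n+1] ⟶ [m+1]` comes from the self-embedding, up to an automorphism of the
target determined by the image and by the label of the last element. -/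
theorem exists_plus_map_comp_swapLast {X Y : FIG G} (p : (plus G).obj X ⟶ (plus G).obj Y) :
    ∃ q : X ⟶ Y,
      (plus G).map q ≫ swapLast Y (p.inj (last X)) (p.lab (last X)) = p := by
  set a := swapLast Y (p.inj (last X)) (p.lab (last X))
  have h := comp_inv_self a
  have h₁ : Hom.inj a (last Y) = p.inj (last X) := swapLast_inj_last _ _ _
  have h₂ : Hom.lab a (last Y) = p.lab (last X) := swapLast_lab_last _ _ _
  obtain ⟨q, hq⟩ := exists_plus_map (X := X) (Y := Y) (p ≫ (a⁻¹ : End ((plus G).obj Y)))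
    (by
      have := congrArg (fun r : (plus G).obj Y ⟶ (plus G).obj Y => r.inj (last Y)) h
      exact (congrArg (Hom.inj (a⁻¹ : End ((plus G).obj Y))) h₁.symm).trans this)
    (by
      have := congrArg (fun r : (plus G).obj Y ⟶ (plus G).obj Y => r.lab (last Y)) h
      refine Eq.trans ?_ this
      exact congrArg₂ (· * ·) h₂.symm (congrArg (Hom.lab (a⁻¹ : End ((plus G).obj Y))) h₁.symm))
  refine ⟨q, ?_⟩
  rw [hq, Category.assoc, inv_comp_self, Category.comp_id]

/-- A morphism `[n+1] ⟶ [m+1]` which hits the last element comes from the self-embedding, up to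
an automorphism of the source. -/
theorem exists_swapLast_inv_comp_plus_map {X Y : FIG G} (p : (plus G).obj X ⟶ (plus G).obj Y)
    (j : Fin ((plus G).obj X).n) (hj : p.inj j = last Y) :
    ∃ q : X ⟶ Y, ((swapLast X j (p.lab j)⁻¹)⁻¹ : End ((plus G).obj X)) ≫ (plus G).map q = p := by
  set a := swapLast X j (p.lab j)⁻¹
  have h₁ : Hom.inj a (last X) = j := swapLast_inj_last _ _ _
  have h₂ : Hom.lab a (last X) = (p.lab j)⁻¹ := swapLast_lab_last _ _ _
  obtain ⟨q, hq⟩ := exists_plus_map (X := X) (Y := Y) (a ≫ p)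
    ((congrArg p.inj h₁).trans hj)
    ((congrArg₂ (· * ·) h₂ (congrArg p.lab h₁)).trans (inv_mul_cancel _))
  refine ⟨q, ?_⟩
  rw [hq, inv_comp_self_assoc]

/-- The automorphisms which exchange `i` with the last element, the label of the last element being
`g`, lie in distinct cosets of the image of the self-embedding. -/
theorem eq_of_plus_map_eq_swapLast_comp_inv {X : FIG G} {i j : Fin ((plus G).obj X).n} {g h : G}
    {q : X ⟶ X}
    (hq : (plus G).map q = (swapLast X i g : (plus G).obj X ⟶ _) ≫
        ((swapLast X j h)⁻¹ : End ((plus G).obj X))) : i = j ∧ g = h := by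
  have hq' : (plus G).map q ≫ swapLast X j h = swapLast X i g := by
    rw [hq, Category.assoc, inv_comp_self, Category.comp_id]
  constructor
  · have := congrArg (fun r : (plus G).obj X ⟶ (plus G).obj X => r.inj (last X)) hq'
    rw [← swapLast_inj_last X i g, ← swapLast_inj_last X j h]
    refine (Eq.trans ?_ this).symm
    exact congrArg (Hom.inj (swapLast X j h)) (plus_map_inj_last q).symm
  · have := congrArg (fun r : (plus G).obj X ⟶ (plus G).obj X => r.lab (last X)) hq'
    rw [← swapLast_lab_last X i g, ← swapLast_lab_last X j h]
    refine (Eq.trans ?_ this).symm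
    refine (one_mul _).symm.trans ?_
    exact congrArg₂ (· * ·) (plus_map_lab_last q).symm
      (congrArg (Hom.lab (swapLast X j h)) (plus_map_inj_last q).symm)

theorem isEmpty_hom_zero (X : FIG G) : IsEmpty ((plus G).obj X ⟶ (⟨0⟩ : FIG G)) :=
  ⟨fun p => (p.inj (last X)).elim0⟩

theorem exists_plus_map_eq_comp_plus_map_iff {X Y Z : FIG G}
    (p : (plus G).obj X ⟶ (plus G).obj Y) (r : Y ⟶ Z) :
    (∃ q : X ⟶ Z, (plus G).map q = p ≫ (plus G).map r) ↔
      ∃ q : X ⟶ Y, (plus G).map q = p := by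
  constructor
  · rintro ⟨q, hq⟩
    have h₁ : ((plus G).map r).inj (p.inj (last X)) =
        ((plus G).map r).inj (last Y) := by
      rw [← comp_inj, ← hq, plus_map_inj_last, plus_map_inj_last]
    have h₁' := ((plus G).map r).inj.injective h₁
    have h₂ : (p ≫ (plus G).map r).lab (last X) = 1 := by rw [← hq, plus_map_lab_last]
    rw [comp_lab, h₁', plus_map_lab_last, mul_one] at h₂
    exact exists_plus_map p h₁' h₂
  · rintro ⟨q, rfl⟩
    exact ⟨q ≫ r, Functor.map_comp _ q r⟩

theorem exists_plus_map_eq_plus_map_comp_iff {X Y Z : FIG G}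
    (p : (plus G).obj Y ⟶ (plus G).obj Z) (r : X ⟶ Y) :
    (∃ q : X ⟶ Z, (plus G).map q = (plus G).map r ≫ p) ↔
      ∃ q : Y ⟶ Z, (plus G).map q = p := by
  constructor
  · rintro ⟨q, hq⟩
    have h₁ : p.inj (last Y) = last Z := by
      rw [← plus_map_inj_last q, hq, comp_inj, plus_map_inj_last]
    have h₂ : p.lab (last Y) = 1 := by
      rw [← plus_map_lab_last q, hq, comp_lab, plus_map_lab_last, one_mul, plus_map_inj_last]
    exact exists_plus_map p h₁ h₂
  · rintro ⟨q, rfl⟩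
    exact ⟨r ≫ q, Functor.map_comp _ r q⟩

theorem exists_comp_incl_eq_comp_plus_map_iff {X Y Z : FIG G} (p : X ⟶ (plus G).obj Y)
    (r : Y ⟶ Z) :
    (∃ q : X ⟶ Z, q ≫ incl Z = p ≫ (plus G).map r) ↔ ∃ q : X ⟶ Y, q ≫ incl Y = p := by
  constructor
  · rintro ⟨q, hq⟩
    refine exists_comp_incl p fun x hx => comp_incl_inj_ne_last q x ?_
    rw [hq, comp_inj, hx, plus_map_inj_last]
  · rintro ⟨q, rfl⟩
    exact ⟨q ≫ r, by rw [Category.assoc, Category.assoc, incl_plus_map]⟩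

theorem comp_incl_ne_plus_map {X Y : FIG G} (q : (plus G).obj X ⟶ Y) (r : X ⟶ Y) :
    q ≫ incl Y ≠ (plus G).map r := fun h =>
  comp_incl_inj_ne_last q (last X) (by rw [h, plus_map_inj_last])

end FIG

namespace FIGMod

variable {k G : Type u} [CommRing k] [Group G]

theorem map_comp_apply (V : FIGMod k G) {X Y Z : FIG G} (p : X ⟶ Y) (q : Y ⟶ Z) (v : V.obj X) :
    V.map (p ≫ q) v = V.map q (V.map p v) := by
  simp

theorem map_id_apply (V : FIGMod k G) {X : FIG G} (v : V.obj X) : V.map (𝟙 X) v = v := by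
  simp

/-! ### Elements of the coinduction -/

/-- An element of `R(V)_n` is the same thing as a family of elements of the `V_m`, indexed by the
morphisms `p : [n] ⟶ [m+1]` and natural in `[m]`; this is the evaluation at `p`. -/
def coindEval (V : FIGMod k G) {X Y : FIG G} (p : X ⟶ (FIG.plus G).obj Y) :
    ((coind k G).obj V).obj X →ₗ[k] V.obj Y where
  toFun φ := NatTrans.app (F := (shift k G).obj (free k X)) (G := V) φ Y (ModuleCat.freeMk p)
  map_add' _ _ := rfl
  map_smul' _ _ := rfl

theorem coind_ext {V : FIGMod k G} {X : FIG G} {φ ψ : ((coind k G).obj V).obj X}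
    (h : ∀ (Y : FIG G) (p : X ⟶ (FIG.plus G).obj Y), coindEval V p φ = coindEval V p ψ) :
    φ = ψ :=
  NatTrans.ext (F := (shift k G).obj (free k X)) (G := V)
    (funext fun Y => ModuleCat.free_hom_ext fun p => h Y p)

theorem map_coindEval (V : FIGMod k G) {X Y Z : FIG G} (p : X ⟶ (FIG.plus G).obj Y) (r : Y ⟶ Z)
    (φ : ((coind k G).obj V).obj X) :
    V.map r (coindEval V p φ) = coindEval V (p ≫ (FIG.plus G).map r) φ := by
  have h := congrArg (fun f => f (ModuleCat.freeMk p))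
    (NatTrans.naturality (F := (shift k G).obj (free k X)) (G := V) φ r)
  refine Eq.trans h.symm ?_
  refine congrArg (NatTrans.app (F := (shift k G).obj (free k X)) (G := V) φ Z) ?_
  exact ModuleCat.free_map_apply _ _

theorem coindEval_map (V : FIGMod k G) {X X' Y : FIG G} (q : X ⟶ X')
    (p : X' ⟶ (FIG.plus G).obj Y) (φ : ((coind k G).obj V).obj X) :
    coindEval V p (((coind k G).obj V).map q φ) = coindEval V (q ≫ p) φ :=
  congrArg (NatTrans.app (F := (shift k G).obj (free k X)) (G := V) φ Y)
    (ModuleCat.free_map_apply _ _)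

theorem coindEval_map_app {V V' : FIGMod k G} (α : V ⟶ V') {X Y : FIG G}
    (p : X ⟶ (FIG.plus G).obj Y) (φ : ((coind k G).obj V).obj X) :
    coindEval V' p (((coind k G).map α).app X φ) = α.app Y (coindEval V p φ) :=
  rfl

/-- The element of `R(V)_n` given by a natural family of elements. -/
def coindMk (V : FIGMod k G) (X : FIG G) (f : ∀ Y : FIG G, (X ⟶ (FIG.plus G).obj Y) → V.obj Y)
    (hf : ∀ (Y Z : FIG G) (p : X ⟶ (FIG.plus G).obj Y) (r : Y ⟶ Z),
      f Z (p ≫ (FIG.plus G).map r) = V.map r (f Y p)) : ((coind k G).obj V).obj X :=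
  show (shift k G).obj (free k X) ⟶ V from
  { app := fun Y => ModuleCat.freeDesc (TypeCat.ofHom (f Y))
    naturality := fun Y Z r => by
      refine ModuleCat.free_hom_ext fun p => ?_
      refine (congrArg (ModuleCat.freeDesc (TypeCat.ofHom (f Z)))
        (ModuleCat.free_map_apply _ _)).trans ?_
      refine (ModuleCat.freeDesc_apply (TypeCat.ofHom (f Z)) _).trans ?_
      refine (hf Y Z p r).trans ?_
      exact (congrArg (V.map r) (ModuleCat.freeDesc_apply (TypeCat.ofHom (f Y)) p)).symm }

theorem coindEval_mk (V : FIGMod k G) (X : FIG G)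
    (f : ∀ Y : FIG G, (X ⟶ (FIG.plus G).obj Y) → V.obj Y)
    (hf : ∀ (Y Z : FIG G) (p : X ⟶ (FIG.plus G).obj Y) (r : Y ⟶ Z),
      f Z (p ≫ (FIG.plus G).map r) = V.map r (f Y p)) {Y : FIG G}
    (p : X ⟶ (FIG.plus G).obj Y) : coindEval V p (coindMk V X f hf) = f Y p :=
  ModuleCat.freeDesc_apply _ _

/-! ### Elements of the induction -/

/-- The element `p ⊗ v` of `L(V)_m`. -/
def indMk (V : FIGMod k G) {X Y : FIG G} (p : (FIG.plus G).obj X ⟶ Y) :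
    V.obj X →ₗ[k] ((ind k G).obj V).obj Y :=
  (indRel V Y).mkQ ∘ₗ
    DirectSum.lof k (FIG G) (fun X => ((FIG.plus G).obj X ⟶ Y) →₀ V.obj X) X ∘ₗ
      Finsupp.lsingle p

theorem indMk_plus_map_comp (V : FIGMod k G) {X X' Y : FIG G} (q : X ⟶ X')
    (p : (FIG.plus G).obj X' ⟶ Y) (v : V.obj X) :
    indMk V ((FIG.plus G).map q ≫ p) v = indMk V p (V.map q v) :=
  (Submodule.Quotient.eq _).mpr (Submodule.subset_span ⟨X, X', q, p, v, rfl⟩)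

theorem map_indMk (V : FIGMod k G) {X Y Z : FIG G} (p : (FIG.plus G).obj X ⟶ Y) (r : Y ⟶ Z)
    (v : V.obj X) : ((ind k G).obj V).map r (indMk V p v) = indMk V (p ≫ r) v :=
  congrArg (indRel V Z).mkQ (indPreMap_tmul V r p v)

theorem map_app_indMk {V V' : FIGMod k G} (α : V ⟶ V') {X Y : FIG G}
    (p : (FIG.plus G).obj X ⟶ Y) (v : V.obj X) :
    ((ind k G).map α).app Y (indMk V p v) = indMk V' p (α.app X v) :=
  congrArg (indRel V' Y).mkQ (indPreMap₂_tmul α p v)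

theorem ind_linearMap_ext {V : FIGMod k G} {Y : FIG G} {A : Type*} [AddCommGroup A] [Module k A]
    {f g : ((ind k G).obj V).obj Y →ₗ[k] A}
    (h : ∀ (X : FIG G) (p : (FIG.plus G).obj X ⟶ Y) (v : V.obj X),
      f (indMk V p v) = g (indMk V p v)) : f = g :=
  ind_hom_ext (V := V) h

theorem ind_ext {V V' : FIGMod k G} {f g : (ind k G).obj V ⟶ V'}
    (h : ∀ (X Y : FIG G) (p : (FIG.plus G).obj X ⟶ Y) (v : V.obj X),
      f.app Y (indMk V p v) = g.app Y (indMk V p v)) : f = g := by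
  ext Y : 3
  exact ind_linearMap_ext fun X p v => h X Y p v

/-- The linear map out of `L(V)_m` given by a compatible family of linear maps. -/
def indLift (V : FIGMod k G) (Y : FIG G) {A : Type*} [AddCommGroup A] [Module k A]
    (f : ∀ X : FIG G, ((FIG.plus G).obj X ⟶ Y) → V.obj X →ₗ[k] A)
    (hf : ∀ (X X' : FIG G) (q : X ⟶ X') (p : (FIG.plus G).obj X' ⟶ Y) (v : V.obj X),
      f X ((FIG.plus G).map q ≫ p) v = f X' p (V.map q v)) :
    ((ind k G).obj V).obj Y →ₗ[k] A :=
  (indRel V Y).liftQ (DirectSum.toModule k (FIG G) A fun X => Finsupp.lsum k (f X)) <| by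
    refine Submodule.span_le.mpr ?_
    rintro _ ⟨X, X', q, p, v, rfl⟩
    refine LinearMap.sub_mem_ker_iff.mpr ?_
    simpa [indTmul] using hf X X' q p v

theorem indLift_mk (V : FIGMod k G) (Y : FIG G) {A : Type*} [AddCommGroup A] [Module k A]
    (f : ∀ X : FIG G, ((FIG.plus G).obj X ⟶ Y) → V.obj X →ₗ[k] A)
    (hf : ∀ (X X' : FIG G) (q : X ⟶ X') (p : (FIG.plus G).obj X' ⟶ Y) (v : V.obj X),
      f X ((FIG.plus G).map q ≫ p) v = f X' p (V.map q v)) {X : FIG G}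
    (p : (FIG.plus G).obj X ⟶ Y) (v : V.obj X) :
    indLift V Y f hf (indMk V p v) = f X p v := by
  refine ((indRel V Y).liftQ_apply _ _).trans ?_
  simp

/-! ### Elements of basic filtered modules -/

/-- The element `p ⊗ w` of `M(W)_m`. -/
def basicMk (n : ℕ) (W : Rep.{u} k (FIG.Grp G n)) {Y : FIG G} (p : (⟨n⟩ : FIG G) ⟶ Y) :
    W →ₗ[k] (basic n W).obj Y :=
  (basicRel n W Y).mkQ ∘ₗ Finsupp.lsingle p

theorem basicMk_comp (n : ℕ) (W : Rep.{u} k (FIG.Grp G n)) {Y : FIG G}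
    (s : FIG.Grp G n) (p : (⟨n⟩ : FIG G) ⟶ Y) (w : W) :
    basicMk n W (s ≫ p) w = basicMk n W p (W.ρ s w) :=
  (Submodule.Quotient.eq _).mpr (Submodule.subset_span ⟨p, s, w, rfl⟩)

theorem map_basicMk (n : ℕ) (W : Rep.{u} k (FIG.Grp G n)) {Y Z : FIG G} (r : Y ⟶ Z)
    (p : (⟨n⟩ : FIG G) ⟶ Y) (w : W) :
    (basic n W).map r (basicMk n W p w) = basicMk n W (p ≫ r) w :=
  congrArg (basicRel n W Z).mkQ (basicMap_single n W r p w)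

theorem basic_linearMap_ext {n : ℕ} {W : Rep.{u} k (FIG.Grp G n)} {Y : FIG G} {A : Type*}
    [AddCommGroup A] [Module k A] {f g : (basic n W).obj Y →ₗ[k] A}
    (h : ∀ (p : (⟨n⟩ : FIG G) ⟶ Y) (w : W), f (basicMk n W p w) = g (basicMk n W p w)) : f = g :=
  Submodule.linearMap_qext _ (Finsupp.lhom_ext fun p w => h p w)

theorem basic_ext {n : ℕ} {W : Rep.{u} k (FIG.Grp G n)} {V : FIGMod k G} {f g : basic n W ⟶ V}
    (h : ∀ (Y : FIG G) (p : (⟨n⟩ : FIG G) ⟶ Y) (w : W),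
      f.app Y (basicMk n W p w) = g.app Y (basicMk n W p w)) : f = g := by
  ext Y : 3
  exact basic_linearMap_ext fun p w => h Y p w

/-- The linear map out of `M(W)_m` given by a compatible family of linear maps. -/
def basicLift (n : ℕ) (W : Rep.{u} k (FIG.Grp G n)) (Y : FIG G) {A : Type*} [AddCommGroup A]
    [Module k A] (f : ((⟨n⟩ : FIG G) ⟶ Y) → W →ₗ[k] A)
    (hf : ∀ (s : FIG.Grp G n) (p : (⟨n⟩ : FIG G) ⟶ Y) (w : W), f (s ≫ p) w = f p (W.ρ s w)) :
    (basic n W).obj Y →ₗ[k] A :=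
  (basicRel n W Y).liftQ (Finsupp.lsum k f) <| by
    refine Submodule.span_le.mpr ?_
    rintro _ ⟨p, s, w, rfl⟩
    refine LinearMap.sub_mem_ker_iff.mpr ?_
    simpa using hf s p w

theorem basicLift_mk (n : ℕ) (W : Rep.{u} k (FIG.Grp G n)) (Y : FIG G) {A : Type*}
    [AddCommGroup A] [Module k A] (f : ((⟨n⟩ : FIG G) ⟶ Y) → W →ₗ[k] A)
    (hf : ∀ (s : FIG.Grp G n) (p : (⟨n⟩ : FIG G) ⟶ Y) (w : W), f (s ≫ p) w = f p (W.ρ s w))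
    (p : (⟨n⟩ : FIG G) ⟶ Y) (w : W) : basicLift n W Y f hf (basicMk n W p w) = f p w := by
  refine ((basicRel n W Y).liftQ_apply _ _).trans ?_
  simp

/-- The map out of `M(W)` determined by an equivariant map out of `W`. -/
def basicDesc (n : ℕ) (W : Rep.{u} k (FIG.Grp G n)) (V : FIGMod k G) (f : W →ₗ[k] V.obj ⟨n⟩)
    (hf : ∀ (s : FIG.Grp G n) (w : W), f (W.ρ s w) = V.map s (f w)) : basic n W ⟶ V where
  app Y := ModuleCat.ofHom <| basicLift n W Y (fun p => (V.map p).hom ∘ₗ f) fun s p w => by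
    simp [hf]
  naturality Y Z r := by
    ext : 1
    refine basic_linearMap_ext fun p w => ?_
    refine (congrArg (basicLift n W Z (fun p => (V.map p).hom ∘ₗ f) fun s p w => by simp [hf])
      (map_basicMk n W r p w)).trans ?_
    refine (basicLift_mk _ _ _ _ _ _ _).trans ((map_comp_apply V p r (f w)).trans ?_)
    exact congrArg (V.map r) (basicLift_mk n W Y (fun p => (V.map p).hom ∘ₗ f)
      (fun s p w => by simp [hf]) p w).symm

theorem basicDesc_mk (n : ℕ) (W : Rep.{u} k (FIG.Grp G n)) (V : FIGMod k G)
    (f : W →ₗ[k] V.obj ⟨n⟩) (hf : ∀ (s : FIG.Grp G n) (w : W), f (W.ρ s w) = V.map s (f w))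
    {Y : FIG G} (p : (⟨n⟩ : FIG G) ⟶ Y) (w : W) :
    (basicDesc n W V f hf).app Y (basicMk n W p w) = V.map p (f w) :=
  basicLift_mk n W Y (fun p => (V.map p).hom ∘ₗ f) (fun s p w => by simp [hf]) p w

/-! ### The adjunctions -/

/-- The map out of `L(V)` given by a compatible and natural family of linear maps. -/
def indDesc (V V' : FIGMod k G)
    (f : ∀ X Y : FIG G, ((FIG.plus G).obj X ⟶ Y) → V.obj X →ₗ[k] V'.obj Y)
    (hf : ∀ (X X' Y : FIG G) (q : X ⟶ X') (p : (FIG.plus G).obj X' ⟶ Y) (v : V.obj X),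
      f X Y ((FIG.plus G).map q ≫ p) v = f X' Y p (V.map q v))
    (hn : ∀ (X Y Z : FIG G) (p : (FIG.plus G).obj X ⟶ Y) (r : Y ⟶ Z) (v : V.obj X),
      f X Z (p ≫ r) v = V'.map r (f X Y p v)) : (ind k G).obj V ⟶ V' where
  app Y := ModuleCat.ofHom <| indLift V Y (fun X p => f X Y p) fun X X' q p v => hf X X' Y q p v
  naturality Y Z r := by
    ext : 1
    refine ind_linearMap_ext fun X p v => ?_
    refine (congrArg (indLift V Z (fun X p => f X Z p) fun X X' q p v => hf X X' Z q p v)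
      (map_indMk V p r v)).trans ?_
    refine (indLift_mk _ _ _ _ _ _).trans ((hn _ _ _ _ _ _).trans ?_)
    exact congrArg (V'.map r)
      (indLift_mk V Y (fun X p => f X Y p) (fun X X' q p v => hf X X' Y q p v) p v).symm

theorem indDesc_mk (V V' : FIGMod k G)
    (f : ∀ X Y : FIG G, ((FIG.plus G).obj X ⟶ Y) → V.obj X →ₗ[k] V'.obj Y)
    (hf : ∀ (X X' Y : FIG G) (q : X ⟶ X') (p : (FIG.plus G).obj X' ⟶ Y) (v : V.obj X),
      f X Y ((FIG.plus G).map q ≫ p) v = f X' Y p (V.map q v))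
    (hn : ∀ (X Y Z : FIG G) (p : (FIG.plus G).obj X ⟶ Y) (r : Y ⟶ Z) (v : V.obj X),
      f X Z (p ≫ r) v = V'.map r (f X Y p v)) {X Y : FIG G} (p : (FIG.plus G).obj X ⟶ Y)
    (v : V.obj X) : (indDesc V V' f hf hn).app Y (indMk V p v) = f X Y p v :=
  indLift_mk V Y (fun X p => f X Y p) (fun X X' q p v => hf X X' Y q p v) p v

variable (k G) in
/-- The unit `v ↦ 𝟙 ⊗ v` of the adjunction between induction and shift. -/
def indUnit : 𝟭 (FIGMod k G) ⟶ ind k G ⋙ shift k G where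
  app V :=
    { app := fun X => ModuleCat.ofHom (indMk V (𝟙 ((FIG.plus G).obj X)))
      naturality := fun X Y q => by
        ext v
        refine (indMk_plus_map_comp V q (𝟙 _) v).symm.trans ?_
        refine Eq.trans ?_ (map_indMk V (𝟙 _) ((FIG.plus G).map q) v).symm
        rw [Category.id_comp, Category.comp_id] }
  naturality V V' α := by
    ext X v
    exact (map_app_indMk α (𝟙 _) v).symm

/-- The counit `p ⊗ v ↦ p v` of the adjunction between induction and shift, on objects. -/
def indCounitApp (V : FIGMod k G) : (ind k G).obj ((shift k G).obj V) ⟶ V :=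
  indDesc ((shift k G).obj V) V (fun _ _ p => (V.map p).hom)
    (fun _ _ _ q p v => map_comp_apply V ((FIG.plus G).map q) p v)
    (fun _ _ _ p r v => map_comp_apply V p r v)

theorem indCounitApp_mk (V : FIGMod k G) {X Y : FIG G} (p : (FIG.plus G).obj X ⟶ Y)
    (v : V.obj ((FIG.plus G).obj X)) :
    (indCounitApp V).app Y (indMk ((shift k G).obj V) p v) = V.map p v :=
  indDesc_mk ((shift k G).obj V) V (fun _ _ p => (V.map p).hom) _ _ p v

variable (k G) in
/-- Induction is left adjoint to the shift. -/
def indShiftAdj : ind k G ⊣ shift k G where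
  unit := indUnit k G
  counit :=
    { app := indCounitApp
      naturality := fun V V' α => by
        refine ind_ext fun X Y p v => ?_
        refine (congrArg ((indCounitApp V').app Y)
          (map_app_indMk ((shift k G).map α) p v)).trans ?_
        refine (indCounitApp_mk V' p (α.app _ v)).trans ?_
        refine (NatTrans.naturality_apply α p v).symm.trans ?_
        exact congrArg (α.app Y) (indCounitApp_mk V p v).symm }
  left_triangle_components V := by
    refine ind_ext fun X Y p v => ?_
    refine (congrArg ((indCounitApp ((ind k G).obj V)).app Y)
      (map_app_indMk ((indUnit k G).app V) p v)).trans ?_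
    refine (indCounitApp_mk ((ind k G).obj V) p _).trans ?_
    refine (map_indMk V (𝟙 _) p v).trans ?_
    rw [Category.id_comp]
    rfl
  right_triangle_components V := by
    ext X v
    exact (indCounitApp_mk V (𝟙 _) v).trans (map_id_apply V v)

/-- The map into `R(V')` given by a family of linear maps which is natural in both variables. -/
def coindLift (V V' : FIGMod k G)
    (f : ∀ X Y : FIG G, (X ⟶ (FIG.plus G).obj Y) → V.obj X →ₗ[k] V'.obj Y)
    (hf : ∀ (X X' Y : FIG G) (q : X ⟶ X') (p : X' ⟶ (FIG.plus G).obj Y) (v : V.obj X),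
      f X Y (q ≫ p) v = f X' Y p (V.map q v))
    (hn : ∀ (X Y Z : FIG G) (p : X ⟶ (FIG.plus G).obj Y) (r : Y ⟶ Z) (v : V.obj X),
      f X Z (p ≫ (FIG.plus G).map r) v = V'.map r (f X Y p v)) : V ⟶ (coind k G).obj V' where
  app X := ModuleCat.ofHom
    { toFun := fun v => coindMk V' X (fun Y p => f X Y p v) fun Y Z p r => hn X Y Z p r v
      map_add' := fun v w => coind_ext fun Y p => by
        refine (coindEval_mk _ _ _ _ _).trans ((map_add (f X Y p) v w).trans ?_)
        exact Eq.trans (congrArg₂ (· + ·)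
          (coindEval_mk V' X (fun Y p => f X Y p v) (fun Y Z p r => hn X Y Z p r v) p).symm
          (coindEval_mk V' X (fun Y p => f X Y p w) (fun Y Z p r => hn X Y Z p r w) p).symm)
          (map_add (coindEval V' p) _ _).symm
      map_smul' := fun c v => coind_ext fun Y p => by
        refine (coindEval_mk _ _ _ _ _).trans ((map_smul (f X Y p) c v).trans ?_)
        exact Eq.trans (congrArg (c • ·)
          (coindEval_mk V' X (fun Y p => f X Y p v) (fun Y Z p r => hn X Y Z p r v) p).symm)
          (map_smul (coindEval V' p) c _).symm }
  naturality X X' q := by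
    ext v
    refine coind_ext fun Z p => ?_
    refine (coindEval_mk V' X' (fun Y p => f X' Y p (V.map q v))
      (fun Y Z p r => hn X' Y Z p r _) p).trans ?_
    refine (hf X X' Z q p v).symm.trans ?_
    refine Eq.trans ?_ (coindEval_map V' q p _).symm
    exact (coindEval_mk V' X (fun Y p => f X Y p v) (fun Y Z p r => hn X Y Z p r _) (q ≫ p)).symm

theorem coindEval_lift (V V' : FIGMod k G)
    (f : ∀ X Y : FIG G, (X ⟶ (FIG.plus G).obj Y) → V.obj X →ₗ[k] V'.obj Y)
    (hf : ∀ (X X' Y : FIG G) (q : X ⟶ X') (p : X' ⟶ (FIG.plus G).obj Y) (v : V.obj X),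
      f X Y (q ≫ p) v = f X' Y p (V.map q v))
    (hn : ∀ (X Y Z : FIG G) (p : X ⟶ (FIG.plus G).obj Y) (r : Y ⟶ Z) (v : V.obj X),
      f X Z (p ≫ (FIG.plus G).map r) v = V'.map r (f X Y p v)) {X Y : FIG G}
    (p : X ⟶ (FIG.plus G).obj Y) (v : V.obj X) :
    coindEval V' p ((coindLift V V' f hf hn).app X v) = f X Y p v :=
  coindEval_mk V' X (fun Y p => f X Y p v) (fun Y Z p r => hn X Y Z p r v) p

/-- The unit `v ↦ (p ↦ p v)` of the adjunction between shift and coinduction, on objects. -/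
def coindUnitApp (V : FIGMod k G) : V ⟶ (coind k G).obj ((shift k G).obj V) :=
  coindLift V ((shift k G).obj V) (fun _ _ p => (V.map p).hom)
    (fun _ _ _ q p v => map_comp_apply V q p v)
    (fun _ _ _ p r v => map_comp_apply V p ((FIG.plus G).map r) v)

theorem coindEval_unitApp (V : FIGMod k G) {X Y : FIG G} (p : X ⟶ (FIG.plus G).obj Y)
    (v : V.obj X) : coindEval ((shift k G).obj V) p ((coindUnitApp V).app X v) = V.map p v :=
  coindEval_lift V ((shift k G).obj V) (fun _ _ p => (V.map p).hom) _ _ p v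

variable (k G) in
/-- Coinduction is right adjoint to the shift. -/
def shiftCoindAdj : shift k G ⊣ coind k G where
  unit :=
    { app := coindUnitApp
      naturality := fun V V' α => by
        ext X v
        refine coind_ext fun Z p => ?_
        refine (coindEval_unitApp V' p (α.app X v)).trans ?_
        refine (NatTrans.naturality_apply α p v).symm.trans ?_
        exact congrArg (α.app _) (coindEval_unitApp V p v).symm }
  counit :=
    { app := fun V =>
        { app := fun Y => ModuleCat.ofHom (coindEval V (𝟙 ((FIG.plus G).obj Y)))
          naturality := fun Y Z r => by
            ext v
            refine (coindEval_map V ((FIG.plus G).map r) (𝟙 _) v).trans ?_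
            refine Eq.trans ?_ (map_coindEval V (𝟙 _) r v).symm
            rw [Category.id_comp, Category.comp_id] }
      naturality := fun V V' α => by
        ext X v
        rfl }
  left_triangle_components V := by
    ext X v
    exact (coindEval_unitApp V (𝟙 _) v).trans (map_id_apply V v)
  right_triangle_components V := by
    ext X v
    refine coind_ext fun Y p => ?_
    refine (congrArg (coindEval V (𝟙 ((FIG.plus G).obj Y)))
      (coindEval_unitApp ((coind k G).obj V) p v)).trans ?_
    refine (coindEval_map V p (𝟙 _) v).trans ?_
    rw [Category.comp_id]
    rfl

/-! ### Exactness of sequences of `FI_G`-modules -/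

theorem exact_iff_app (S : ShortComplex (FIGMod k G)) :
    S.Exact ↔ ∀ X : FIG G, Function.Exact (S.f.app X) (S.g.app X) := by
  have key : S.Exact ↔ ∀ X : FIG G, (S.map ((evaluation _ _).obj X)).Exact := by
    refine ⟨fun h X => h.map _, fun h => ?_⟩
    rw [ShortComplex.exact_iff_isZero_homology]
    refine Functor.isZero _ fun X => ?_
    exact ((ShortComplex.exact_iff_isZero_homology _).mp (h X)).of_iso
      (S.mapHomologyIso ((evaluation _ _).obj X)).symm
  rw [key]
  exact forall_congr' fun X => ShortComplex.ShortExact.moduleCat_exact_iff_function_exact _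

theorem mono_iff_app {V V' : FIGMod k G} (α : V ⟶ V') :
    Mono α ↔ ∀ X : FIG G, Function.Injective (α.app X) := by
  simp only [NatTrans.mono_iff_mono_app, ModuleCat.mono_iff_injective]

theorem epi_iff_app {V V' : FIGMod k G} (α : V ⟶ V') :
    Epi α ↔ ∀ X : FIG G, Function.Surjective (α.app X) := by
  simp only [NatTrans.epi_iff_epi_app, ModuleCat.epi_iff_surjective]

/-! ### The sequence relating induction and coinduction -/

/-- The action of a morphism `[n+1] ⟶ [m+1]` on `V_n`, extended by zero: a morphism which comes
from `q : [n] ⟶ [m]` acts as `q`, and every other morphism acts as zero. -/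
def plusPart (V : FIGMod k G) {X Y : FIG G} (p : (FIG.plus G).obj X ⟶ (FIG.plus G).obj Y) :
    V.obj X →ₗ[k] V.obj Y :=
  open Classical in
  if h : ∃ q : X ⟶ Y, (FIG.plus G).map q = p then (V.map h.choose).hom else 0

theorem plusPart_plus_map (V : FIGMod k G) {X Y : FIG G} (q : X ⟶ Y) (v : V.obj X) :
    plusPart V ((FIG.plus G).map q) v = V.map q v := by
  have h : ∃ q' : X ⟶ Y, (FIG.plus G).map q' = (FIG.plus G).map q := ⟨q, rfl⟩
  rw [plusPart, dif_pos h, FIG.plus_map_injective h.choose_spec]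

theorem plusPart_of_not (V : FIGMod k G) {X Y : FIG G}
    {p : (FIG.plus G).obj X ⟶ (FIG.plus G).obj Y}
    (h : ¬ ∃ q : X ⟶ Y, (FIG.plus G).map q = p) (v : V.obj X) : plusPart V p v = 0 := by
  rw [plusPart, dif_neg h, LinearMap.zero_apply]

theorem plusPart_comp (V : FIGMod k G) {X Y Z : FIG G}
    (p : (FIG.plus G).obj X ⟶ (FIG.plus G).obj Y) (r : Y ⟶ Z) (v : V.obj X) :
    plusPart V (p ≫ (FIG.plus G).map r) v = V.map r (plusPart V p v) := by
  by_cases h : ∃ q : X ⟶ Y, (FIG.plus G).map q = p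
  · obtain ⟨q, rfl⟩ := h
    rw [← Functor.map_comp, plusPart_plus_map, plusPart_plus_map, map_comp_apply]
  · rw [plusPart_of_not V h, plusPart_of_not V
      ((FIG.exists_plus_map_eq_comp_plus_map_iff p r).not.mpr h), map_zero]

theorem plusPart_plus_map_comp (V : FIGMod k G) {X Y Z : FIG G} (r : X ⟶ Y)
    (p : (FIG.plus G).obj Y ⟶ (FIG.plus G).obj Z) (v : V.obj X) :
    plusPart V ((FIG.plus G).map r ≫ p) v = plusPart V p (V.map r v) := by
  by_cases h : ∃ q : Y ⟶ Z, (FIG.plus G).map q = p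
  · obtain ⟨q, rfl⟩ := h
    rw [← Functor.map_comp, plusPart_plus_map, plusPart_plus_map, map_comp_apply]
  · rw [plusPart_of_not V h, plusPart_of_not V
      ((FIG.exists_plus_map_eq_plus_map_comp_iff p r).not.mpr h)]

theorem plusPart_naturality {V V' : FIGMod k G} (α : V ⟶ V') {X Y : FIG G}
    (p : (FIG.plus G).obj X ⟶ (FIG.plus G).obj Y) (v : V.obj X) :
    plusPart V' p (α.app X v) = α.app Y (plusPart V p v) := by
  by_cases h : ∃ q : X ⟶ Y, (FIG.plus G).map q = p
  · obtain ⟨q, rfl⟩ := h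
    rw [plusPart_plus_map, plusPart_plus_map]
    exact (NatTrans.naturality_apply α q v).symm
  · rw [plusPart_of_not V h, plusPart_of_not V' h, map_zero]

/-- The linear map `p ⊗ v ↦ (r ∘ p) v` on `L(V)_n` attached to `r : [n] ⟶ [m+1]`, where `r ∘ p`
acts through its part coming from the self-embedding. -/
def indPlusPart (V : FIGMod k G) {X Y : FIG G} (r : X ⟶ (FIG.plus G).obj Y) :
    ((ind k G).obj V).obj X →ₗ[k] V.obj Y :=
  indLift V X (fun _ p => plusPart V (p ≫ r)) fun X X' q p v => by
    rw [Category.assoc, plusPart_plus_map_comp]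

theorem indPlusPart_mk (V : FIGMod k G) {X Y Z : FIG G} (p : (FIG.plus G).obj X ⟶ Y)
    (r : Y ⟶ (FIG.plus G).obj Z) (v : V.obj X) :
    indPlusPart V r (indMk V p v) = plusPart V (p ≫ r) v :=
  indLift_mk V Y (fun _ p => plusPart V (p ≫ r))
    (fun X X' q p v => by rw [Category.assoc, plusPart_plus_map_comp]) p v

/-- The natural map `L(V) ⟶ R(V)`; it sends `p ⊗ v` to the family whose member at `r` is
`(r ∘ p) v`, where `r ∘ p` acts through its part coming from the self-embedding. -/
def indToCoind (V : FIGMod k G) : (ind k G).obj V ⟶ (coind k G).obj V :=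
  coindLift ((ind k G).obj V) V (fun _ _ r => indPlusPart V r)
    (fun X X' Y q p => LinearMap.congr_fun (f := indPlusPart V (q ≫ p))
      (g := indPlusPart V p ∘ₗ (((ind k G).obj V).map q).hom) <|
      ind_linearMap_ext fun X'' r v => by
        refine (indPlusPart_mk V r (q ≫ p) v).trans ?_
        refine Eq.trans ?_ (congrArg (indPlusPart V p) (map_indMk V r q v).symm)
        rw [indPlusPart_mk, Category.assoc])
    (fun X Y Z p r => LinearMap.congr_fun (f := indPlusPart V (p ≫ (FIG.plus G).map r))
      (g := (V.map r).hom ∘ₗ indPlusPart V p) <|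
      ind_linearMap_ext fun X'' q v => by
        refine (indPlusPart_mk V q _ v).trans ?_
        refine Eq.trans ?_ (congrArg (V.map r) (indPlusPart_mk V q p v).symm)
        rw [← plusPart_comp, Category.assoc])

theorem coindEval_indToCoind_mk (V : FIGMod k G) {X Y Z : FIG G} (p : (FIG.plus G).obj X ⟶ Y)
    (r : Y ⟶ (FIG.plus G).obj Z) (v : V.obj X) :
    coindEval V r ((indToCoind V).app Y (indMk V p v)) = plusPart V (p ≫ r) v :=
  (coindEval_lift ((ind k G).obj V) V (fun _ _ r => indPlusPart V r) _ _ r _).trans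
    (indPlusPart_mk V p r v)

variable (k G) in
/-- The natural map `R(V) ⟶ V`, the evaluation at the standard inclusions. -/
def coindProj : coind k G ⟶ 𝟭 (FIGMod k G) where
  app V :=
    { app := fun X => ModuleCat.ofHom (coindEval V (FIG.incl X))
      naturality := fun X Y q => by
        ext φ
        refine (coindEval_map V q (FIG.incl Y) φ).trans ?_
        rw [← FIG.incl_plus_map]
        exact (map_coindEval V (FIG.incl X) q φ).symm }
  naturality V V' α := by
    ext X φ
    rfl

theorem coindProj_apply (V : FIGMod k G) (X : FIG G) (φ : ((coind k G).obj V).obj X) :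
    ((coindProj k G).app V).app X φ = coindEval V (FIG.incl X) φ :=
  rfl

theorem indToCoind_coindProj (V : FIGMod k G) : indToCoind V ≫ (coindProj k G).app V = 0 := by
  refine ind_ext fun X Y p v => ?_
  refine (coindEval_indToCoind_mk V p (FIG.incl Y) v).trans ?_
  exact plusPart_of_not V (fun ⟨q, hq⟩ => FIG.comp_incl_ne_plus_map p q hq.symm) v

theorem coindEval_incl_indToCoind (V : FIGMod k G) {X : FIG G} (x : ((ind k G).obj V).obj X) :
    coindEval V (FIG.incl X) ((indToCoind V).app X x) = 0 :=
  congrArg (fun α : (ind k G).obj V ⟶ V => α.app X x) (indToCoind_coindProj V)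

theorem coindProj_surjective (V : FIGMod k G) (X : FIG G) :
    Function.Surjective (((coindProj k G).app V).app X) := by
  classical
  intro v
  refine ⟨coindMk V X (fun Y p => if h : ∃ q : X ⟶ Y, q ≫ FIG.incl Y = p then
    V.map h.choose v else 0) fun Y Z p r => ?_, ?_⟩
  · by_cases h : ∃ q : X ⟶ Y, q ≫ FIG.incl Y = p
    · have h' := (FIG.exists_comp_incl_eq_comp_plus_map_iff p r).mpr h
      rw [dif_pos h, dif_pos h', ← map_comp_apply]
      congr 2
      refine congrArg _ (FIG.comp_incl_injective ?_)
      change h'.choose ≫ FIG.incl Z = (h.choose ≫ r) ≫ FIG.incl Z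
      rw [h'.choose_spec, Category.assoc, ← FIG.incl_plus_map, ← Category.assoc, h.choose_spec]
    · rw [dif_neg h, dif_neg ((FIG.exists_comp_incl_eq_comp_plus_map_iff p r).not.mpr h), map_zero]
  · refine (coindProj_apply V X _).trans ((coindEval_mk V X _ _ _).trans ?_)
    have h : ∃ q : X ⟶ X, q ≫ FIG.incl X = FIG.incl X := ⟨𝟙 X, Category.id_comp _⟩
    rw [dif_pos h]
    have : h.choose = 𝟙 X := FIG.comp_incl_injective (h.choose_spec.trans (Category.id_comp _).symm)
    rw [this, map_id_apply]

/-- The map from a direct sum of copies of `V_n` to `L(V)_{n+1}`, indexed by the possible images and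
labels of the last element; it is bijective. -/
def indSum (V : FIGMod k G) (X : FIG G) :
    (Fin ((FIG.plus G).obj X).n × G →₀ V.obj X) →ₗ[k]
      ((ind k G).obj V).obj ((FIG.plus G).obj X) :=
  Finsupp.lsum k fun i => indMk V (FIG.swapLast X i.1 i.2)

theorem indSum_surjective (V : FIGMod k G) (X : FIG G) : Function.Surjective (indSum V X) := by
  rw [← LinearMap.range_eq_top, ← Submodule.ker_mkQ (indSum V X).range, LinearMap.ker_eq_top]
  refine ind_linearMap_ext fun X' p v => ?_
  obtain ⟨q, hq⟩ := FIG.exists_plus_map_comp_swapLast p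
  refine (Submodule.Quotient.mk_eq_zero _).mpr
    ⟨Finsupp.single (p.inj (FIG.last X'), p.lab (FIG.last X')) (V.map q v), ?_⟩
  refine (Finsupp.lsum_single k _ _ _).trans ?_
  rw [← indMk_plus_map_comp, hq]

/-- Evaluating the image of `L(V)` in `R(V)` at the inverses of the automorphisms which index the
direct sum recovers the summands. This shows both that the sum is direct and that `L(V) ⟶ R(V)` is
injective. -/
theorem coindEval_indToCoind_indSum (V : FIGMod k G) (X : FIG G)
    (f : Fin ((FIG.plus G).obj X).n × G →₀ V.obj X) (i : Fin ((FIG.plus G).obj X).n × G) :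
    coindEval V ((FIG.swapLast X i.1 i.2)⁻¹ : End ((FIG.plus G).obj X))
      ((indToCoind V).app _ (indSum V X f)) = f i := by
  classical
  revert f
  refine LinearMap.congr_fun (f := coindEval V _ ∘ₗ ((indToCoind V).app _).hom ∘ₗ indSum V X)
    (g := Finsupp.lapply i) (Finsupp.lhom_ext fun j v => ?_)
  refine (congrArg (fun x => coindEval V _ ((indToCoind V).app _ x))
    (Finsupp.lsum_single k _ _ _)).trans ?_
  refine (coindEval_indToCoind_mk V _ _ v).trans ?_
  rw [Finsupp.lapply_apply, Finsupp.single_apply]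
  split_ifs with h
  · subst h
    rw [FIG.comp_inv_self]
    rw [← (FIG.plus G).map_id]
    exact (plusPart_plus_map V (𝟙 X) v).trans (map_id_apply V v)
  · refine plusPart_of_not V (fun ⟨q, hq⟩ => h ?_) v
    obtain ⟨h₁, h₂⟩ := FIG.eq_of_plus_map_eq_swapLast_comp_inv hq
    exact Prod.ext h₁ h₂

theorem eq_zero_or_exists_eq_plus (X : FIG G) :
    X = ⟨0⟩ ∨ ∃ X' : FIG G, X = (FIG.plus G).obj X' := by
  obtain ⟨_ | n⟩ := X
  · exact Or.inl rfl
  · exact Or.inr ⟨⟨n⟩, rfl⟩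

theorem indSum_injective (V : FIGMod k G) (X : FIG G) : Function.Injective (indSum V X) := by
  intro f g h
  ext i
  rw [← coindEval_indToCoind_indSum V X f i, ← coindEval_indToCoind_indSum V X g i, h]

theorem ind_zero (V : FIGMod k G) (x : ((ind k G).obj V).obj ⟨0⟩) : x = 0 := by
  have : (LinearMap.id : ((ind k G).obj V).obj ⟨0⟩ →ₗ[k] _) = 0 :=
    ind_linearMap_ext fun X p => ((FIG.isEmpty_hom_zero X).false p).elim
  exact LinearMap.congr_fun this x

theorem indToCoind_injective (V : FIGMod k G) (X : FIG G) :
    Function.Injective ((indToCoind V).app X) := by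
  obtain rfl | ⟨X, rfl⟩ := eq_zero_or_exists_eq_plus X
  · intro x y _
    rw [ind_zero V x, ind_zero V y]
  · intro x y h
    obtain ⟨f, rfl⟩ := indSum_surjective V X x
    obtain ⟨g, rfl⟩ := indSum_surjective V X y
    congr 1
    ext i
    rw [← coindEval_indToCoind_indSum V X f i, ← coindEval_indToCoind_indSum V X g i, h]

/-- A family whose member at the standard inclusion vanishes is supported on the morphisms which hit
the last element. -/
theorem coindEval_eq_zero {V : FIGMod k G} {X : FIG G} {φ : ((coind k G).obj V).obj X}
    (hφ : coindEval V (FIG.incl X) φ = 0) {Y : FIG G} (p : X ⟶ (FIG.plus G).obj Y)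
    (hp : ∀ x, p.inj x ≠ FIG.last Y) : coindEval V p φ = 0 := by
  obtain ⟨q, rfl⟩ := FIG.exists_comp_incl p hp
  rw [← FIG.incl_plus_map, ← map_coindEval, hφ, map_zero]

/-- A family in the kernel of `R(V) ⟶ V` comes from `L(V)`: it is determined by its members at the
inverses of the automorphisms which index the direct sum `L(V)_{n+1}`, and these can be prescribed.
The group `G` has to be finite, since `R(V)_{n+1}` contains a product over `[n+1] × G`. -/
theorem exists_indToCoind_eq [Finite G] (V : FIGMod k G) {X : FIG G}
    (φ : ((coind k G).obj V).obj X) (hφ : coindEval V (FIG.incl X) φ = 0) :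
    ∃ x, (indToCoind V).app X x = φ := by
  obtain rfl | ⟨X, rfl⟩ := eq_zero_or_exists_eq_plus X
  · refine ⟨0, ?_⟩
    rw [map_zero]
    refine coind_ext fun Y p => ?_
    rw [map_zero, coindEval_eq_zero hφ p fun x => x.elim0]
  · refine ⟨indSum V X (Finsupp.equivFunOnFinite.symm fun i =>
      coindEval V ((FIG.swapLast X i.1 i.2)⁻¹ : End ((FIG.plus G).obj X)) φ), ?_⟩
    rw [← sub_eq_zero]
    set ψ := _ - φ with hψ
    have h₁ : coindEval V (FIG.incl _) ψ = 0 := by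
      rw [hψ, map_sub, hφ, sub_zero]
      exact coindEval_incl_indToCoind V _
    have h₂ (i : Fin ((FIG.plus G).obj X).n × G) :
        coindEval V ((FIG.swapLast X i.1 i.2)⁻¹ : End ((FIG.plus G).obj X)) ψ = 0 := by
      rw [hψ, map_sub, coindEval_indToCoind_indSum, sub_eq_zero]
      rfl
    refine coind_ext fun Y p => ?_
    rw [map_zero]
    by_cases hp : ∃ j, p.inj j = FIG.last Y
    · obtain ⟨j, hj⟩ := hp
      obtain ⟨q, hq⟩ := FIG.exists_swapLast_inv_comp_plus_map p j hj
      rw [← hq, ← map_coindEval, h₂ (j, _), map_zero]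
    · exact coindEval_eq_zero h₁ p (not_exists.mp hp)

/-- The short complex `L(V) ⟶ R(V) ⟶ V`. -/
def indCoindComplex (V : FIGMod k G) : ShortComplex (FIGMod k G) :=
  ShortComplex.mk (indToCoind V) ((coindProj k G).app V) (indToCoind_coindProj V)

theorem indCoindComplex_shortExact [Finite G] (V : FIGMod k G) :
    (indCoindComplex V).ShortExact where
  exact := (exact_iff_app _).mpr fun X φ =>
    ⟨fun h => exists_indToCoind_eq V φ h, by
      rintro ⟨x, rfl⟩
      exact coindEval_incl_indToCoind V x⟩
  mono_f := (mono_iff_app _).mpr (indToCoind_injective V)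
  epi_g := (epi_iff_app _).mpr (coindProj_surjective V)

/-! ### Exactness of the three functors -/

instance : (shift k G).Additive where
  map_add := rfl

instance : (ind k G).Additive := (indShiftAdj k G).left_adjoint_additive
instance : (coind k G).Additive := (shiftCoindAdj k G).right_adjoint_additive

instance : (shift k G).Linear k where
  map_smul _ _ := rfl

instance : (coind k G).Linear k where
  map_smul _ _ := by
    ext X φ
    rfl

instance : PreservesFiniteLimits (shift k G) :=
  inferInstanceAs (PreservesFiniteLimits ((Functor.whiskeringLeft _ _ _).obj (FIG.plus G)))
instance : PreservesFiniteColimits (shift k G) :=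
  inferInstanceAs (PreservesFiniteColimits ((Functor.whiskeringLeft _ _ _).obj (FIG.plus G)))

instance : PreservesFiniteColimits (ind k G) :=
  have := (indShiftAdj k G).leftAdjoint_preservesColimits
  inferInstance

instance : PreservesFiniteLimits (coind k G) :=
  have := (shiftCoindAdj k G).rightAdjoint_preservesLimits
  inferInstance

/-- On degree `n + 1`, the map is a direct sum of copies of the map on degree `n`. -/
theorem ind_map_injective {V V' : FIGMod k G} (α : V ⟶ V')
    (hα : ∀ X, Function.Injective (α.app X)) (X : FIG G) :
    Function.Injective (((ind k G).map α).app X) := by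
  obtain rfl | ⟨X, rfl⟩ := eq_zero_or_exists_eq_plus X
  · intro x y _
    rw [ind_zero V x, ind_zero V y]
  · have key : ∀ f, ((ind k G).map α).app _ (indSum V X f) =
        indSum V' X (Finsupp.mapRange.linearMap (α.app X).hom f) := by
      refine LinearMap.congr_fun (f := (((ind k G).map α).app _).hom ∘ₗ indSum V X)
        (g := indSum V' X ∘ₗ Finsupp.mapRange.linearMap (α.app X).hom)
        (Finsupp.lhom_ext fun i v => ?_)
      refine (congrArg (((ind k G).map α).app _) (Finsupp.lsum_single k _ _ _)).trans ?_
      refine (map_app_indMk α _ v).trans ?_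
      refine Eq.trans ?_ (congrArg (indSum V' X) (Finsupp.mapRange_single (hf := map_zero _)).symm)
      exact (Finsupp.lsum_single k (fun i : _ × G => indMk V' (FIG.swapLast X i.1 i.2)) _ _).symm
    intro x y h
    obtain ⟨f, rfl⟩ := indSum_surjective V X x
    obtain ⟨g, rfl⟩ := indSum_surjective V X y
    rw [key, key] at h
    rw [Finsupp.mapRange_injective _ (map_zero _) (hα X) (indSum_injective V' X h)]

instance : PreservesFiniteLimits (ind k G) := by
  rw [Functor.preservesFiniteLimits_iff_forall_exact_map_and_mono]
  intro S hS
  refine ⟨((Functor.preservesFiniteColimits_iff_forall_exact_map_and_epi (ind k G)).mp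
    inferInstance S hS).1, (mono_iff_app _).mpr ?_⟩
  exact ind_map_injective S.f ((mono_iff_app _).mp hS.mono_f)

/-- A diagram chase in the natural sequence `0 ⟶ L ⟶ R ⟶ id ⟶ 0`, where `L` preserves
epimorphisms as a left adjoint. -/
theorem coind_map_surjective [Finite G] {V V' : FIGMod k G} (α : V ⟶ V')
    (hα : ∀ X, Function.Surjective (α.app X)) (X : FIG G) :
    Function.Surjective (((coind k G).map α).app X) := by
  intro φ
  have : Epi α := (epi_iff_app α).mpr hα
  obtain ⟨v, hv⟩ := hα X (coindEval V' (FIG.incl X) φ)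
  obtain ⟨ψ, hψ⟩ := coindProj_surjective V X v
  obtain ⟨x, hx⟩ := exists_indToCoind_eq V' (φ - ((coind k G).map α).app X ψ) (by
    rw [map_sub, coindEval_map_app, ← coindProj_apply V, hψ, hv, sub_self])
  obtain ⟨y, rfl⟩ := (epi_iff_app ((ind k G).map α)).mp inferInstance X x
  refine ⟨ψ + (indToCoind V).app X y, ?_⟩
  have h : indToCoind V ≫ (coind k G).map α = (ind k G).map α ≫ indToCoind V' := by
    refine ind_ext fun X Y p v => coind_ext fun Z r => ?_
    refine (congrArg (α.app Z) (coindEval_indToCoind_mk V p r v)).trans ?_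
    refine (plusPart_naturality α (p ≫ r) v).symm.trans ?_
    refine (coindEval_indToCoind_mk V' p r _).symm.trans ?_
    exact congrArg (fun x => coindEval V' r ((indToCoind V').app Y x)) (map_app_indMk α p v).symm
  rw [map_add]
  refine (congrArg _ (congrArg (fun β => β.app X y) h)).trans ?_
  exact (congrArg _ hx).trans (add_sub_cancel _ _)

instance [Finite G] : PreservesFiniteColimits (coind k G) := by
  rw [Functor.preservesFiniteColimits_iff_forall_exact_map_and_epi]
  intro S hS
  refine ⟨((Functor.preservesFiniteLimits_iff_forall_exact_map_and_mono (coind k G)).mp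
    inferInstance S hS).1, (epi_iff_app _).mpr ?_⟩
  exact coind_map_surjective S.g ((epi_iff_app _).mp hS.epi_g)

/-! ### Basic filtered modules as a left adjoint -/

theorem basicMk_id_ρ (n : ℕ) (W : Rep.{u} k (FIG.Grp G n)) (s : FIG.Grp G n) (w : W) :
    basicMk n W (𝟙 _) (W.ρ s w) = (basic n W).map s (basicMk n W (𝟙 _) w) := by
  rw [← basicMk_comp, map_basicMk, Category.id_comp, Category.comp_id]

/-- The map `M(W) ⟶ M(W')` induced by an equivariant map. -/
def basicMap₂ {n : ℕ} {W W' : Rep.{u} k (FIG.Grp G n)} (f : W ⟶ W') : basic n W ⟶ basic n W' :=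
  basicDesc n W (basic n W') (basicMk n W' (𝟙 _) ∘ₗ f.hom.toLinearMap) fun s w =>
    (congrArg (basicMk n W' (𝟙 _)) (Rep.hom_comm_apply f s w)).trans (basicMk_id_ρ n W' s _)

theorem basicMap₂_mk {n : ℕ} {W W' : Rep.{u} k (FIG.Grp G n)} (f : W ⟶ W') {Y : FIG G}
    (p : (⟨n⟩ : FIG G) ⟶ Y) (w : W) :
    (basicMap₂ f).app Y (basicMk n W p w) = basicMk n W' p (f.hom w) := by
  refine (basicDesc_mk n W (basic n W') (basicMk n W' (𝟙 _) ∘ₗ f.hom.toLinearMap) _ p w).trans ?_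
  refine (map_basicMk n W' p (𝟙 _) _).trans ?_
  rw [Category.id_comp]
  rfl

variable (k G) in
/-- The functor `W ↦ M(W)`. -/
def basicFunctor (n : ℕ) : Rep.{u} k (FIG.Grp G n) ⥤ FIGMod k G where
  obj W := basic n W
  map f := basicMap₂ f
  map_id W := basic_ext fun Y p w => basicMap₂_mk (𝟙 W) p w
  map_comp f g := basic_ext fun Y p w => by
    refine (basicMap₂_mk (f ≫ g) p w).trans ?_
    refine Eq.trans ?_ (congrArg ((basicMap₂ g).app Y) (basicMap₂_mk f p w)).symm
    exact (basicMap₂_mk g p _).symm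

variable (k G) in
/-- The evaluation `V ↦ V_n`, as a functor to the representations of `G_n`. -/
def evRep (n : ℕ) : FIGMod k G ⥤ Rep.{u} k (FIG.Grp G n) where
  obj V := Rep.of (X := V.obj ⟨n⟩)
    { toFun := fun s => (V.map s).hom
      map_one' := by
        ext v
        exact map_id_apply V v
      map_mul' := fun s t => by
        ext v
        exact map_comp_apply V t s v }
  map α := Rep.ofHom ⟨(α.app _).hom, fun s => by
    ext v
    exact NatTrans.naturality_apply α (X := ⟨n⟩) (Y := ⟨n⟩) s v⟩

/-- The map `M(W) ⟶ V` which corresponds to an equivariant map `W ⟶ V_n`. -/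
def basicHom {n : ℕ} {W : Rep.{u} k (FIG.Grp G n)} {V : FIGMod k G}
    (f : W ⟶ (evRep k G n).obj V) : basic n W ⟶ V :=
  basicDesc n W V f.hom.toLinearMap fun s w => Rep.hom_comm_apply f s w

theorem basicHom_mk {n : ℕ} {W : Rep.{u} k (FIG.Grp G n)} {V : FIGMod k G}
    (f : W ⟶ (evRep k G n).obj V) {Y : FIG G} (p : (⟨n⟩ : FIG G) ⟶ Y) (w : W) :
    (basicHom f).app Y (basicMk n W p w) = V.map p (f.hom w) :=
  basicDesc_mk n W V f.hom.toLinearMap _ p w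

/-- The equivariant map `W ⟶ V_n` which corresponds to a map `M(W) ⟶ V`. -/
def basicRestrict {n : ℕ} {W : Rep.{u} k (FIG.Grp G n)} {V : FIGMod k G} (α : basic n W ⟶ V) :
    W ⟶ (evRep k G n).obj V :=
  Rep.ofHom ⟨(α.app _).hom ∘ₗ basicMk n W (𝟙 _), fun s => by
    ext w
    refine (congrArg (α.app _) (basicMk_id_ρ n W s w)).trans ?_
    exact NatTrans.naturality_apply α (X := ⟨n⟩) (Y := ⟨n⟩) s _⟩

variable (k G) in
/-- Maps `M(W) ⟶ V` correspond to equivariant maps `W ⟶ V_n`. -/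
def basicAdj (n : ℕ) : basicFunctor k G n ⊣ evRep k G n :=
  Adjunction.mkOfHomEquiv
    { homEquiv := fun W V =>
        { toFun := basicRestrict
          invFun := basicHom
          left_inv := fun α => basic_ext fun Y p w => by
            refine (basicHom_mk _ p w).trans ?_
            refine (NatTrans.naturality_apply α p _).symm.trans ?_
            refine congrArg (α.app Y) ((map_basicMk n W p (𝟙 _) w).trans ?_)
            rw [Category.id_comp]
          right_inv := fun f => by
            ext w
            exact (basicHom_mk f (𝟙 _) w).trans (map_id_apply V _) }
      homEquiv_naturality_left_symm := fun {W W'} V f g => basic_ext fun Y p w => by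
        refine (basicHom_mk (f ≫ g) p w).trans ?_
        refine Eq.trans ?_ (congrArg ((basicHom g).app Y) (basicMap₂_mk f p w)).symm
        exact (basicHom_mk g p _).symm
      homEquiv_naturality_right := fun _ _ => rfl }

/-- Evaluating the shift at `[n]` is the same thing as restricting the evaluation at `[n+1]`. -/
def shiftEvRepIso (n : ℕ) : evRep k G (n + 1) ⋙ Rep.resFunctor (FIG.grpPlus G n) ≅
    shift k G ⋙ evRep k G n :=
  NatIso.ofComponents (fun _ => Iso.refl _) fun _ => rfl

/-- `L(M(W)) ≅ M(Ind W)`: both sides are left adjoint to the same functor. -/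
def indBasicIso (n : ℕ) (W : Rep.{u} k (FIG.Grp G n)) :
    (ind k G).obj (basic n W) ≅ basic (n + 1) (Rep.ind (FIG.grpPlus G n) W) :=
  (((basicAdj k G n).comp (indShiftAdj k G)).leftAdjointUniq
    (((Rep.indResAdjunction k (FIG.grpPlus G n)).comp (basicAdj k G (n + 1))).ofNatIsoRight
      (shiftEvRepIso n))).app W

/-! ### The shift of a basic filtered module -/

variable (k G) in
/-- The natural map `V ⟶ Σ V` given by the standard inclusions. -/
def toShift : 𝟭 (FIGMod k G) ⟶ shift k G where
  app V :=
    { app := fun X => V.map (FIG.incl X)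
      naturality := fun X Y q => by
        refine (V.map_comp _ _).symm.trans (Eq.trans ?_ (V.map_comp _ _))
        exact congrArg V.map (FIG.incl_plus_map q).symm }
  naturality V V' α := by
    ext X : 2
    exact (α.naturality _).symm

theorem toShift_basicMk (n : ℕ) (W : Rep.{u} k (FIG.Grp G n)) {Y : FIG G}
    (p : (⟨n⟩ : FIG G) ⟶ Y) (w : W) :
    ((toShift k G).app (basic n W)).app Y (basicMk n W p w) =
      basicMk n W (p ≫ FIG.incl Y) w :=
  map_basicMk n W (FIG.incl Y) p w

/-- A retraction of `M(W) ⟶ Σ M(W)`: it sends `p ⊗ w` to itself if `p` avoids the last element, and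
to zero otherwise. -/
def basicRetr (n : ℕ) (W : Rep.{u} k (FIG.Grp G n)) (Y : FIG G)
    (p : (⟨n⟩ : FIG G) ⟶ (FIG.plus G).obj Y) : W →ₗ[k] (basic n W).obj Y :=
  open Classical in
  if h : ∃ q : (⟨n⟩ : FIG G) ⟶ Y, q ≫ FIG.incl Y = p then basicMk n W h.choose else 0

theorem basicRetr_incl (n : ℕ) (W : Rep.{u} k (FIG.Grp G n)) {Y : FIG G}
    (q : (⟨n⟩ : FIG G) ⟶ Y) : basicRetr n W Y (q ≫ FIG.incl Y) = basicMk n W q := by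
  have h : ∃ q' : (⟨n⟩ : FIG G) ⟶ Y, q' ≫ FIG.incl Y = q ≫ FIG.incl Y := ⟨q, rfl⟩
  rw [basicRetr, dif_pos h, FIG.comp_incl_injective h.choose_spec]

theorem basicRetr_of_not (n : ℕ) (W : Rep.{u} k (FIG.Grp G n)) {Y : FIG G}
    {p : (⟨n⟩ : FIG G) ⟶ (FIG.plus G).obj Y}
    (h : ¬ ∃ q : (⟨n⟩ : FIG G) ⟶ Y, q ≫ FIG.incl Y = p) : basicRetr n W Y p = 0 := by
  rw [basicRetr, dif_neg h]

theorem basicRetr_comp (n : ℕ) (W : Rep.{u} k (FIG.Grp G n)) {Y : FIG G}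
    (s : FIG.Grp G n) (p : (⟨n⟩ : FIG G) ⟶ (FIG.plus G).obj Y) (w : W) :
    basicRetr n W Y (s ≫ p) w = basicRetr n W Y p (W.ρ s w) := by
  by_cases h : ∃ q : (⟨n⟩ : FIG G) ⟶ Y, q ≫ FIG.incl Y = p
  · obtain ⟨q, rfl⟩ := h
    rw [← Category.assoc, basicRetr_incl, basicRetr_incl, basicMk_comp]
  · rw [basicRetr_of_not n W h, basicRetr_of_not n W (p := s ≫ p) fun ⟨q, hq⟩ => h
      ⟨((s⁻¹ : FIG.Grp G n) : (⟨n⟩ : FIG G) ⟶ ⟨n⟩) ≫ q, by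
        rw [Category.assoc, hq, FIG.inv_comp_self_assoc]⟩]
    rfl

theorem basicRetr_comp_plus_map (n : ℕ) (W : Rep.{u} k (FIG.Grp G n)) {Y Z : FIG G}
    (p : (⟨n⟩ : FIG G) ⟶ (FIG.plus G).obj Y) (r : Y ⟶ Z) (w : W) :
    basicRetr n W Z (p ≫ (FIG.plus G).map r) w = (basic n W).map r (basicRetr n W Y p w) := by
  by_cases h : ∃ q : (⟨n⟩ : FIG G) ⟶ Y, q ≫ FIG.incl Y = p
  · obtain ⟨q, rfl⟩ := h
    rw [Category.assoc, FIG.incl_plus_map, ← Category.assoc, basicRetr_incl, basicRetr_incl,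
      map_basicMk]
  · rw [basicRetr_of_not n W h, basicRetr_of_not n W
      ((FIG.exists_comp_incl_eq_comp_plus_map_iff p r).not.mpr h)]
    exact (map_zero _).symm

/-- The map out of `Σ M(W)` given by a compatible and natural family of linear maps. -/
def shiftBasicDesc (n : ℕ) (W : Rep.{u} k (FIG.Grp G n)) (V : FIGMod k G)
    (f : ∀ Y : FIG G, ((⟨n⟩ : FIG G) ⟶ (FIG.plus G).obj Y) → W →ₗ[k] V.obj Y)
    (hf : ∀ (Y : FIG G) (s : FIG.Grp G n) (p : (⟨n⟩ : FIG G) ⟶ (FIG.plus G).obj Y) (w : W),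
      f Y (s ≫ p) w = f Y p (W.ρ s w))
    (hn : ∀ (Y Z : FIG G) (p : (⟨n⟩ : FIG G) ⟶ (FIG.plus G).obj Y) (r : Y ⟶ Z) (w : W),
      f Z (p ≫ (FIG.plus G).map r) w = V.map r (f Y p w)) :
    (shift k G).obj (basic n W) ⟶ V where
  app Y := ModuleCat.ofHom (basicLift n W ((FIG.plus G).obj Y) (f Y) (hf Y))
  naturality Y Z r := by
    ext : 1
    refine basic_linearMap_ext fun p w => ?_
    refine (congrArg (basicLift n W ((FIG.plus G).obj Z) (f Z) (hf Z))
      (map_basicMk n W ((FIG.plus G).map r) p w)).trans ?_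
    refine (basicLift_mk _ _ _ _ _ _ _).trans ((hn Y Z p r w).trans ?_)
    exact congrArg (V.map r) (basicLift_mk n W ((FIG.plus G).obj Y) (f Y) (hf Y) p w).symm

theorem shiftBasicDesc_mk (n : ℕ) (W : Rep.{u} k (FIG.Grp G n)) (V : FIGMod k G)
    (f : ∀ Y : FIG G, ((⟨n⟩ : FIG G) ⟶ (FIG.plus G).obj Y) → W →ₗ[k] V.obj Y)
    (hf : ∀ (Y : FIG G) (s : FIG.Grp G n) (p : (⟨n⟩ : FIG G) ⟶ (FIG.plus G).obj Y) (w : W),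
      f Y (s ≫ p) w = f Y p (W.ρ s w))
    (hn : ∀ (Y Z : FIG G) (p : (⟨n⟩ : FIG G) ⟶ (FIG.plus G).obj Y) (r : Y ⟶ Z) (w : W),
      f Z (p ≫ (FIG.plus G).map r) w = V.map r (f Y p w)) {Y : FIG G}
    (p : (⟨n⟩ : FIG G) ⟶ (FIG.plus G).obj Y) (w : W) :
    (shiftBasicDesc n W V f hf hn).app Y (basicMk n W p w) = f Y p w :=
  basicLift_mk n W ((FIG.plus G).obj Y) (f Y) (hf Y) p w

theorem shiftBasic_ext {n : ℕ} {W : Rep.{u} k (FIG.Grp G n)} {V : FIGMod k G}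
    {f g : (shift k G).obj (basic n W) ⟶ V}
    (h : ∀ (Y : FIG G) (p : (⟨n⟩ : FIG G) ⟶ (FIG.plus G).obj Y) (w : W),
      f.app Y (basicMk n W p w) = g.app Y (basicMk n W p w)) : f = g := by
  ext Y : 3
  exact basic_linearMap_ext fun p w => h Y p w

/-- The retraction of `M(W) ⟶ Σ M(W)` which kills `p ⊗ w` if `p` hits the last element. -/
def shiftBasicRetr (n : ℕ) (W : Rep.{u} k (FIG.Grp G n)) :
    (shift k G).obj (basic n W) ⟶ basic n W :=
  shiftBasicDesc n W (basic n W) (basicRetr n W) (fun _ => basicRetr_comp n W)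
    (fun _ _ => basicRetr_comp_plus_map n W)

theorem shiftBasicRetr_mk (n : ℕ) (W : Rep.{u} k (FIG.Grp G n)) {Y : FIG G}
    (p : (⟨n⟩ : FIG G) ⟶ (FIG.plus G).obj Y) (w : W) :
    (shiftBasicRetr n W).app Y (basicMk n W p w) = basicRetr n W Y p w :=
  shiftBasicDesc_mk n W (basic n W) (basicRetr n W) _ _ p w

theorem toShift_shiftBasicRetr (n : ℕ) (W : Rep.{u} k (FIG.Grp G n)) :
    (toShift k G).app (basic n W) ≫ shiftBasicRetr n W = 𝟙 _ := by
  refine basic_ext fun Y p w => ?_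
  refine (congrArg ((shiftBasicRetr n W).app Y) (toShift_basicMk n W p w)).trans ?_
  rw [shiftBasicRetr_mk, basicRetr_incl]
  rfl

/-- `Σ M(W) ≅ M(W)` in degree zero: every morphism out of `[0]` avoids the last element. -/
def shiftBasicZeroIso (W : Rep.{u} k (FIG.Grp G 0)) :
    (shift k G).obj (basic 0 W) ≅ basic 0 W where
  hom := shiftBasicRetr 0 W
  inv := (toShift k G).app (basic 0 W)
  hom_inv_id := shiftBasic_ext fun Y p w => by
    obtain ⟨q, rfl⟩ := FIG.exists_comp_incl p fun x => x.elim0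
    refine (congrArg (((toShift k G).app (basic 0 W)).app Y)
      (shiftBasicRetr_mk 0 W (q ≫ FIG.incl Y) w)).trans ?_
    rw [basicRetr_incl, toShift_basicMk]
    rfl
  inv_hom_id := toShift_shiftBasicRetr 0 W

/-- `(a, q) ↦ q ⊗ a w`, where `p = ι(q) ∘ a` hits the last element; zero if `p` avoids the last
element. -/
def basicHit (n : ℕ) (W : Rep.{u} k (FIG.Grp G (n + 1))) (Y : FIG G)
    (p : (⟨n + 1⟩ : FIG G) ⟶ (FIG.plus G).obj Y) :
    W →ₗ[k] (basic n (Rep.res (FIG.grpPlus G n) W)).obj Y :=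
  open Classical in
  if h : ∃ x : FIG.Grp G (n + 1) × ((⟨n⟩ : FIG G) ⟶ Y), x.1 ≫ (FIG.plus G).map x.2 = p then
    basicMk n (Rep.res (FIG.grpPlus G n) W) h.choose.2 ∘ₗ W.ρ h.choose.1
  else 0

theorem basicMk_res_eq (n : ℕ) (W : Rep.{u} k (FIG.Grp G (n + 1))) {Y : FIG G}
    {a b : FIG.Grp G (n + 1)} {q r : (⟨n⟩ : FIG G) ⟶ Y}
    (h : (a : (⟨n + 1⟩ : FIG G) ⟶ ⟨n + 1⟩) ≫ (FIG.plus G).map q = b ≫ (FIG.plus G).map r) (w : W) :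
    basicMk n (Rep.res (FIG.grpPlus G n) W) q (W.ρ a w) =
      basicMk n (Rep.res (FIG.grpPlus G n) W) r (W.ρ b w) := by
  have key : (((b⁻¹ : FIG.Grp G (n + 1)) : (⟨n + 1⟩ : FIG G) ⟶ ⟨n + 1⟩) ≫ a) ≫
      (FIG.plus G).map q = (FIG.plus G).map r :=
    (Category.assoc _ _ _).trans ((congrArg _ h).trans (FIG.inv_comp_self_assoc b _))
  obtain ⟨t, ht⟩ := (FIG.exists_plus_map_eq_comp_plus_map_iff (X := ⟨n⟩) (Y := ⟨n⟩)
    (((b⁻¹ : FIG.Grp G (n + 1)) : (⟨n + 1⟩ : FIG G) ⟶ ⟨n + 1⟩) ≫ a) q).mp ⟨r, key.symm⟩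
  have hr : r = t ≫ q := FIG.plus_map_injective <| by
    rw [Functor.map_comp, ht]
    exact key.symm
  have ha : a = FIG.grpPlus G n t * b := by
    refine Eq.trans ?_ (congrArg (fun x => (b : (⟨n + 1⟩ : FIG G) ⟶ ⟨n + 1⟩) ≫ x) ht.symm)
    exact (FIG.comp_inv_self_assoc b a).symm
  rw [hr, ha, map_mul]
  exact (basicMk_comp n (Rep.res (FIG.grpPlus G n) W) t q (W.ρ b w)).symm

theorem basicHit_comp_plus_map (n : ℕ) (W : Rep.{u} k (FIG.Grp G (n + 1))) {Y : FIG G}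
    (a : FIG.Grp G (n + 1)) (q : (⟨n⟩ : FIG G) ⟶ Y) (w : W) :
    basicHit n W Y (a ≫ (FIG.plus G).map q) w =
      basicMk n (Rep.res (FIG.grpPlus G n) W) q (W.ρ a w) := by
  have h : ∃ x : FIG.Grp G (n + 1) × ((⟨n⟩ : FIG G) ⟶ Y),
    x.1 ≫ (FIG.plus G).map x.2 = a ≫ (FIG.plus G).map q := ⟨(a, q), rfl⟩
  rw [basicHit, dif_pos h]
  exact basicMk_res_eq n W h.choose_spec w

theorem exists_eq_comp_plus_map {n : ℕ} {Y : FIG G} (p : (⟨n + 1⟩ : FIG G) ⟶ (FIG.plus G).obj Y) :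
    (∃ q : (⟨n + 1⟩ : FIG G) ⟶ Y, p = q ≫ FIG.incl Y) ∨
      ∃ (a : FIG.Grp G (n + 1)) (q : (⟨n⟩ : FIG G) ⟶ Y), p = a ≫ (FIG.plus G).map q := by
  by_cases hp : ∃ j, p.inj j = FIG.last Y
  · obtain ⟨j, hj⟩ := hp
    obtain ⟨q, hq⟩ := FIG.exists_swapLast_inv_comp_plus_map (X := ⟨n⟩) p j hj
    exact Or.inr ⟨_, q, hq.symm⟩
  · obtain ⟨q, hq⟩ := FIG.exists_comp_incl p (not_exists.mp hp)
    exact Or.inl ⟨q, hq.symm⟩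

theorem comp_incl_ne_comp_plus_map {n : ℕ} {Y : FIG G} (q : (⟨n + 1⟩ : FIG G) ⟶ Y)
    (a : FIG.Grp G (n + 1)) (r : (⟨n⟩ : FIG G) ⟶ Y) : q ≫ FIG.incl Y ≠ a ≫ (FIG.plus G).map r := by
  intro h
  refine FIG.comp_incl_ne_plus_map (X := ⟨n⟩)
    (((a⁻¹ : FIG.Grp G (n + 1)) : (⟨n + 1⟩ : FIG G) ⟶ ⟨n + 1⟩) ≫ q) r ?_
  refine (Category.assoc _ _ _).trans ((congrArg _ h).trans ?_)
  exact FIG.inv_comp_self_assoc a _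

theorem basicHit_comp_incl (n : ℕ) (W : Rep.{u} k (FIG.Grp G (n + 1))) {Y : FIG G}
    (q : (⟨n + 1⟩ : FIG G) ⟶ Y) (w : W) : basicHit n W Y (q ≫ FIG.incl Y) w = 0 := by
  rw [basicHit, dif_neg fun ⟨x, hx⟩ => comp_incl_ne_comp_plus_map q x.1 x.2 hx.symm,
    LinearMap.zero_apply]

theorem basicRetr_plus_map (n : ℕ) (W : Rep.{u} k (FIG.Grp G (n + 1))) {Y : FIG G}
    (a : FIG.Grp G (n + 1)) (q : (⟨n⟩ : FIG G) ⟶ Y) :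
    basicRetr (n + 1) W Y (a ≫ (FIG.plus G).map q) = 0 :=
  basicRetr_of_not _ _ fun ⟨r, hr⟩ => comp_incl_ne_comp_plus_map r a q hr

/-- The projection of `Σ M(W)` to `M(Res W)`, supported on the `p ⊗ w` such that `p` hits the last
element. -/
def shiftBasicHit (n : ℕ) (W : Rep.{u} k (FIG.Grp G (n + 1))) :
    (shift k G).obj (basic (n + 1) W) ⟶ basic n (Rep.res (FIG.grpPlus G n) W) :=
  shiftBasicDesc (n + 1) W _ (basicHit n W)
    (fun Y s p w => by
      obtain ⟨q, rfl⟩ | ⟨a, q, rfl⟩ := exists_eq_comp_plus_map p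
      · rw [← Category.assoc, basicHit_comp_incl, basicHit_comp_incl]
      · refine (congrArg (fun x => basicHit n W Y x w) (Category.assoc _ _ _).symm).trans ?_
        refine (basicHit_comp_plus_map n W (a * s) q w).trans ?_
        rw [basicHit_comp_plus_map, map_mul]
        rfl)
    (fun Y Z p r w => by
      obtain ⟨q, rfl⟩ | ⟨a, q, rfl⟩ := exists_eq_comp_plus_map p
      · rw [Category.assoc, FIG.incl_plus_map, ← Category.assoc, basicHit_comp_incl,
          basicHit_comp_incl, map_zero]
      · rw [basicHit_comp_plus_map]
        refine Eq.trans ?_ (map_basicMk n (Rep.res (FIG.grpPlus G n) W) r q _).symm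
        refine Eq.trans ?_ (basicHit_comp_plus_map n W a (q ≫ r) w)
        rw [Functor.map_comp]
        exact congrArg (fun x => basicHit n W Z x w) (Category.assoc _ _ _))

theorem shiftBasicHit_mk (n : ℕ) (W : Rep.{u} k (FIG.Grp G (n + 1))) {Y : FIG G}
    (p : (⟨n + 1⟩ : FIG G) ⟶ (FIG.plus G).obj Y) (w : W) :
    (shiftBasicHit n W).app Y (basicMk (n + 1) W p w) = basicHit n W Y p w :=
  shiftBasicDesc_mk (n + 1) W _ (basicHit n W) _ _ p w

/-- The map `M(Res W) ⟶ Σ M(W)` which sends `q ⊗ w` to `ι(q) ⊗ w`. -/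
def resToShift (n : ℕ) (W : Rep.{u} k (FIG.Grp G (n + 1))) :
    basic n (Rep.res (FIG.grpPlus G n) W) ⟶ (shift k G).obj (basic (n + 1) W) :=
  basicDesc n _ _ (basicMk (n + 1) W (𝟙 _)) fun s w =>
    basicMk_id_ρ (n + 1) W (FIG.grpPlus G n s) w

theorem resToShift_mk (n : ℕ) (W : Rep.{u} k (FIG.Grp G (n + 1))) {Y : FIG G}
    (q : (⟨n⟩ : FIG G) ⟶ Y) (w : W) :
    (resToShift n W).app Y (basicMk n (Rep.res (FIG.grpPlus G n) W) q w) =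
      basicMk (n + 1) W ((FIG.plus G).map q) w := by
  refine (basicDesc_mk n (Rep.res (FIG.grpPlus G n) W) _ _ _ q w).trans ?_
  refine (map_basicMk (n + 1) W ((FIG.plus G).map q) (𝟙 _) w).trans ?_
  exact congrArg (fun x => basicMk (n + 1) W x w) (Category.id_comp _)

/-- The split short complex `M(Res W) ⟶ Σ M(W) ⟶ M(W)`. -/
def shiftBasicComplex (n : ℕ) (W : Rep.{u} k (FIG.Grp G (n + 1))) : ShortComplex (FIGMod k G) :=
  ShortComplex.mk (resToShift n W) (shiftBasicRetr (n + 1) W) <| basic_ext fun Y q w => by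
    refine (congrArg ((shiftBasicRetr (n + 1) W).app Y) (resToShift_mk n W q w)).trans ?_
    refine (shiftBasicRetr_mk (n + 1) W _ w).trans ?_
    refine (congrArg (fun x => basicRetr (n + 1) W Y x w) (Category.id_comp _).symm).trans ?_
    exact LinearMap.congr_fun (basicRetr_plus_map n W (𝟙 _) q) w

/-- The splitting given by the two cases: `p` hits the last element, or avoids it. -/
def shiftBasicSplitting (n : ℕ) (W : Rep.{u} k (FIG.Grp G (n + 1))) :
    (shiftBasicComplex n W).Splitting where
  r := shiftBasicHit n W
  s := (toShift k G).app (basic (n + 1) W)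
  f_r := basic_ext fun Y q w => by
    refine (congrArg ((shiftBasicHit n W).app Y) (resToShift_mk n W q w)).trans ?_
    refine (shiftBasicHit_mk n W _ w).trans ?_
    refine (congrArg (fun x => basicHit n W Y x w) (Category.id_comp _).symm).trans ?_
    refine (basicHit_comp_plus_map n W (𝟙 _) q w).trans ?_
    exact congrArg (basicMk n (Rep.res (FIG.grpPlus G n) W) q)
      (LinearMap.congr_fun (map_one W.ρ) w)
  s_g := toShift_shiftBasicRetr (n + 1) W
  id := shiftBasic_ext fun Y p w => by
    refine (congrArg₂ (· + ·)
      (congrArg ((resToShift n W).app Y) (shiftBasicHit_mk n W p w))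
      (congrArg (((toShift k G).app (basic (n + 1) W)).app Y)
        (shiftBasicRetr_mk (n + 1) W p w))).trans ?_
    obtain ⟨q, rfl⟩ | ⟨a, q, rfl⟩ := exists_eq_comp_plus_map p
    · rw [basicHit_comp_incl, basicRetr_incl, map_zero, zero_add, toShift_basicMk]
      rfl
    · rw [basicHit_comp_plus_map, basicRetr_plus_map, LinearMap.zero_apply, map_zero, add_zero]
      exact (resToShift_mk n W q _).trans (basicMk_comp (n + 1) W a _ w).symm

/-- `Σ M(W) ≅ M(W) ⊕ M(Res W)` in positive degree. -/
def shiftBasicSuccIso (n : ℕ) (W : Rep.{u} k (FIG.Grp G (n + 1))) :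
    (shift k G).obj (basic (n + 1) W) ≅
      basic (n + 1) W ⊞ basic n (Rep.res (FIG.grpPlus G n) W) :=
  (shiftBasicSplitting n W).isoBinaryBiproduct ≪≫ biprod.braiding _ _

/-! ### The coinduction of a basic filtered module -/

/-- A retraction of `V ⟶ Σ V` gives rise to a section of `R(V) ⟶ V`. -/
theorem coindProj_section {V : FIGMod k G} (r : (shift k G).obj V ⟶ V)
    (hr : (toShift k G).app V ≫ r = 𝟙 V) :
    (coindUnitApp V ≫ (coind k G).map r) ≫ (coindProj k G).app V = 𝟙 V := by
  ext X v
  refine (coindEval_map_app r (FIG.incl X) _).trans ?_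
  refine (congrArg (r.app X) (coindEval_unitApp V (FIG.incl X) v)).trans ?_
  exact congrArg (fun α : V ⟶ V => α.app X v) hr

/-- `R(V) ≅ V ⊕ L(V)`, if `V ⟶ Σ V` has a retraction. -/
def coindIso [Finite G] {V : FIGMod k G} (r : (shift k G).obj V ⟶ V)
    (hr : (toShift k G).app V ≫ r = 𝟙 V) : (coind k G).obj V ≅ V ⊞ (ind k G).obj V :=
  (ShortComplex.Splitting.ofExactOfSection (indCoindComplex V) (indCoindComplex_shortExact V).exact
    (coindUnitApp V ≫ (coind k G).map r) (coindProj_section r hr)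
    (indCoindComplex_shortExact V).mono_f).isoBinaryBiproduct ≪≫ biprod.braiding _ _

/-- `R(M(W)) ≅ M(W) ⊕ M(Ind W)`. -/
def coindBasicIso [Finite G] (n : ℕ) (W : Rep.{u} k (FIG.Grp G n)) :
    (coind k G).obj (basic n W) ≅
      basic n W ⊞ basic (n + 1) (Rep.ind (FIG.grpPlus G n) W) :=
  coindIso (shiftBasicRetr n W) (toShift_shiftBasicRetr n W) ≪≫
    biprod.mapIso (Iso.refl _) (indBasicIso n W)

/-! ### Extensions of basic filtered modules -/

/-- `W` is the degree `n` part of `M(W)`; the inverse sends `p ⊗ w` to `p w`. -/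
theorem basicMk_id_bijective (n : ℕ) (W : Rep.{u} k (FIG.Grp G n)) :
    Function.Bijective (basicMk n W (𝟙 (⟨n⟩ : FIG G))) := by
  constructor
  · refine Function.LeftInverse.injective
      (g := basicLift n W ⟨n⟩ (fun p => W.ρ p) fun s p w => ?_) fun w => ?_
    · exact LinearMap.congr_fun (map_mul W.ρ (show FIG.Grp G n from p) s) w
    · refine (basicLift_mk n W ⟨n⟩ _ _ _ w).trans ?_
      exact LinearMap.congr_fun (map_one W.ρ) w
  · rw [← LinearMap.range_eq_top]
    refine Submodule.eq_top_iff'.mpr fun x => ?_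
    obtain ⟨x, rfl⟩ := Submodule.mkQ_surjective _ x
    induction x using Finsupp.induction_linear with
    | zero => exact ⟨0, (map_zero _).trans (map_zero _).symm⟩
    | add x y hx hy => rw [map_add]; exact add_mem hx hy
    | single p w =>
      refine ⟨W.ρ p w, (basicMk_comp n W (p : FIG.Grp G n) (𝟙 _) w).symm.trans ?_⟩
      exact congrArg (fun q => basicMk n W q w) (Category.comp_id p)

/-- Equivalently, `W ↦ M(W)` is fully faithful. -/
instance (n : ℕ) : IsIso (basicAdj k G n).unit := by
  have (W : Rep.{u} k (FIG.Grp G n)) : IsIso ((basicAdj k G n).unit.app W) := by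
    have : IsIso ((forget₂ (Rep k _) (ModuleCat k)).map ((basicAdj k G n).unit.app W)) :=
      (ConcreteCategory.isIso_iff_bijective _).mpr (basicMk_id_bijective n W)
    exact isIso_of_reflects_iso _ (forget₂ (Rep k _) (ModuleCat k))
  exact NatIso.isIso_of_isIso_app _

instance (n : ℕ) : (evRep k G n).Additive where
  map_add := rfl

instance (n : ℕ) : (basicFunctor k G n).Additive :=
  (basicAdj k G n).left_adjoint_additive

instance (n : ℕ) : PreservesFiniteColimits (basicFunctor k G n) := by
  have := (basicAdj k G n).leftAdjoint_preservesColimits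
  infer_instance

instance (n : ℕ) : PreservesFiniteColimits (evRep k G n) := by
  have : PreservesFiniteColimits (evRep k G n ⋙ forget₂ (Rep k _) (ModuleCat.{u} k)) :=
    inferInstanceAs (PreservesFiniteColimits ((evaluation (FIG G) (ModuleCat.{u} k)).obj ⟨n⟩))
  exact ⟨fun J _ _ => preservesColimitsOfShape_of_reflects_of_preserves _
    (forget₂ (Rep k _) (ModuleCat.{u} k))⟩

/-- `B ≅ M(W)` for some `k G_n`-module `W`. -/
def IsBasic (n : ℕ) (B : FIGMod k G) : Prop :=
  ∃ W : Rep.{u} k (FIG.Grp G n), Nonempty (B ≅ basic n W)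

theorem IsBasic.of_iso {n : ℕ} {B B' : FIGMod k G} (e : B ≅ B') : IsBasic n B → IsBasic n B'
  | ⟨W, ⟨i⟩⟩ => ⟨W, ⟨e.symm ≪≫ i⟩⟩

/-- The modules isomorphic to some `M(W)` are those with `M(V_n) ≅ V` under the counit. -/
theorem isBasic_iff (n : ℕ) (B : FIGMod k G) :
    IsBasic n B ↔ IsIso ((basicAdj k G n).counit.app B) := by
  have := (basicAdj k G n).fullyFaithfulLOfIsIsoUnit.full
  have := (basicAdj k G n).fullyFaithfulLOfIsIsoUnit.faithful
  refine ⟨fun ⟨W, ⟨e⟩⟩ => (basicAdj k G n).isIso_counit_app_of_iso (X := B) (Y := W) e, fun h => ?_⟩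
  exact ⟨_, ⟨(asIso ((basicAdj k G n).counit.app B)).symm⟩⟩

/-- An extension of basic filtered modules of the same degree is a basic filtered module: applying
the counit to it gives a map of short exact sequences which is an isomorphism at both ends. -/
theorem IsBasic.of_shortExact {n : ℕ} {S : ShortComplex (FIGMod k G)} (hS : S.ShortExact)
    (h₁ : IsBasic n S.X₁) (h₃ : IsBasic n S.X₃) : IsBasic n S.X₂ := by
  rw [isBasic_iff] at *
  let ε := (basicAdj k G n).counit
  let T := evRep k G n ⋙ basicFunctor k G n
  have hT : PreservesFiniteColimits T := comp_preservesFiniteColimits _ _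
  obtain ⟨hT₁, hT₂⟩ := T.preservesFiniteColimits_iff_forall_exact_map_and_epi.mp hT S hS
  have := hS.mono_f
  -- Naturality at `S.f`, whose source has an invertible counit, replaces left exactness of `T`.
  have : Mono (T.map S.f ≫ ε.app S.X₂) := by
    rw [show T.map S.f ≫ ε.app S.X₂ = ε.app S.X₁ ≫ S.f from ε.naturality S.f]
    have : Mono (ε.app S.X₁) := @IsIso.mono_of_iso _ _ _ _ _ h₁
    exact mono_comp (ε.app S.X₁) S.f
  have hST : (S.map T).ShortExact :=
    { exact := hT₁
      mono_f := mono_of_mono (T.map S.f) (ε.app S.X₂)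
      epi_g := hT₂ }
  let φ := S.mapNatTrans ε
  have : IsIso φ.τ₁ := h₁
  have : IsIso φ.τ₃ := h₃
  exact ShortComplex.isIso₂_of_shortExact_of_isIso₁₃ (S₁ := S.map T) (S₂ := S.map (𝟭 _)) φ hST hS

/-! ### Filtrations with basic filtered quotients -/

/-- There is a filtration `0 = A 0 ⊆ ⋯ ⊆ A n = V` such that `A (i + 1) / A i ≅ M(W)` for some
`k G_i`-module `W`, for every `i < n`. -/
def HasFilt : ℕ → FIGMod k G → Prop
  | 0, V => IsZero V
  | n + 1, V => ∃ (A : FIGMod k G) (f : A ⟶ V), Mono f ∧ HasFilt n A ∧ IsBasic n (cokernel f)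

theorem isBasic_of_isZero (n : ℕ) {B : FIGMod k G} (h : IsZero B) : IsBasic n B :=
  ⟨_, ⟨h.iso ((basicFunctor k G n).map_isZero (isZero_zero _))⟩⟩

theorem HasFilt.of_iso {n : ℕ} {V V' : FIGMod k G} (e : V ≅ V') (h : HasFilt n V) :
    HasFilt n V' := by
  cases n with
  | zero => exact IsZero.of_iso h e.symm
  | succ n =>
    obtain ⟨A, f, _, hA, hB⟩ := h
    exact ⟨A, f ≫ e.hom, inferInstance, hA, hB.of_iso (cokernelCompIsIso f e.hom).symm⟩

theorem HasFilt.of_shortExact {n : ℕ} {S : ShortComplex (FIGMod k G)} (hS : S.ShortExact)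
    (h₁ : HasFilt n S.X₁) (h₃ : IsBasic n S.X₃) : HasFilt (n + 1) S.X₂ :=
  ⟨S.X₁, S.f, hS.mono_f, h₁,
    h₃.of_iso (IsColimit.coconePointUniqueUpToIso hS.gIsCokernel (colimit.isColimit _))⟩

theorem HasFilt.exists_shortExact {n : ℕ} {V : FIGMod k G} (h : HasFilt (n + 1) V) :
    ∃ (A B : FIGMod k G) (f : A ⟶ V) (g : V ⟶ B) (w : f ≫ g = 0),
      (ShortComplex.mk f g w).ShortExact ∧ HasFilt n A ∧ IsBasic n B := by
  obtain ⟨A, f, _, hA, hB⟩ := h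
  exact ⟨A, cokernel f, f, cokernel.π f, cokernel.condition f,
    { exact := ShortComplex.exact_cokernel f
      mono_f := inferInstanceAs (Mono f)
      epi_g := inferInstanceAs (Epi (cokernel.π f)) }, hA, hB⟩

/-- The zero module is a basic filtered module of every degree. -/
theorem HasFilt.succ {n : ℕ} {V : FIGMod k G} (h : HasFilt n V) : HasFilt (n + 1) V :=
  ⟨V, 𝟙 V, inferInstance, h, isBasic_of_isZero n (isZero_cokernel_of_epi (𝟙 V))⟩

/-- An extension of `M(W)` by a module whose last filtration quotient has the same degree as `M(W)`:
the last quotient is replaced by an extension of basic filtered modules of that degree. -/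
theorem HasFilt.of_shortExact_same {n : ℕ} {S : ShortComplex (FIGMod k G)} (hS : S.ShortExact)
    (h₁ : HasFilt (n + 1) S.X₁) (h₃ : IsBasic n S.X₃) : HasFilt (n + 1) S.X₂ := by
  obtain ⟨A, i, _, hA, hB⟩ := h₁
  have := hS.mono_f
  exact ⟨A, i ≫ S.f, inferInstance, hA, IsBasic.of_shortExact (shortExact_cokernel_comp i S.f) hB
    (h₃.of_iso (IsColimit.coconePointUniqueUpToIso hS.gIsCokernel (colimit.isColimit _)))⟩

/-- An extension by a module with a filtration up to degree `n`, whose quotient is a sum of basic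
filtered modules of degrees `n` and `n + 1`: the first summand is absorbed into the quotient of
degree `n`, the second one becomes a new quotient. -/
theorem HasFilt.of_shortExact_biprod {n : ℕ} {S : ShortComplex (FIGMod k G)} (hS : S.ShortExact)
    (h₁ : HasFilt (n + 1) S.X₁) {P Q : FIGMod k G} (e : S.X₃ ≅ P ⊞ Q) (hP : IsBasic n P)
    (hQ : IsBasic (n + 1) Q) : HasFilt (n + 2) S.X₂ := by
  have := hS.epi_g
  let g : S.X₂ ⟶ P ⊞ Q := S.g ≫ e.hom
  have h₁' : HasFilt (n + 1) (kernel g) := h₁.of_iso <|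
    IsLimit.conePointUniqueUpToIso hS.fIsKernel (limit.isLimit _) ≪≫ (kernelCompMono S.g e.hom).symm
  have hK : HasFilt (n + 1) (kernel (g ≫ biprod.snd)) :=
    HasFilt.of_shortExact_same (shortExact_kernel_comp g biprod.snd) h₁'
      (hP.of_iso (kernelBiprodSndIso (X := P) (Y := Q)).symm)
  refine HasFilt.of_shortExact (S := ShortComplex.mk (kernel.ι (g ≫ biprod.snd)) (g ≫ biprod.snd)
    (kernel.condition _)) ?_ hK hQ
  exact { exact := ShortComplex.exact_kernel _
          mono_f := inferInstanceAs (Mono (kernel.ι _))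
          epi_g := inferInstanceAs (Epi (g ≫ biprod.snd)) }

/-! ### Sharp filtrations as filtrations by subobjects -/

/-- The filtration of the submodule `A` is pushed forward to `V` and completed by `V` itself. -/
theorem HasFilt.exists_subobject {n : ℕ} {V : FIGMod k G} (h : HasFilt n V) :
    ∃ F : ℕ → Subobject V, F 0 = ⊥ ∧ F n = ⊤ ∧ ∀ i < n, ∃ h : F i ≤ F (i + 1),
      IsBasic i (cokernel (Subobject.ofLE (F i) (F (i + 1)) h)) := by
  induction n generalizing V with
  | zero =>
    refine ⟨fun _ => ⊥, rfl, ?_, fun i hi => (Nat.not_lt_zero i hi).elim⟩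
    rw [← Subobject.isIso_arrow_iff_eq_top]
    exact IsZero.isIso (Subobject.botCoeIsoZero.symm.isZero_iff.mp (isZero_zero _)) h _
  | succ n ih =>
    obtain ⟨A, f, _, hA, hB⟩ := h
    obtain ⟨F, h₀, hn, hF⟩ := ih hA
    let F' (i : ℕ) : Subobject V := if i ≤ n then Subobject.mk ((F i).arrow ≫ f) else ⊤
    have h₁ (i : ℕ) (hi : i ≤ n) : F' i = Subobject.mk ((F i).arrow ≫ f) := if_pos hi
    have h₂ : F' (n + 1) = Subobject.mk (𝟙 V) :=
      (if_neg (Nat.not_succ_le_self n)).trans (Subobject.top_eq_id V)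
    refine ⟨F', ?_, h₂.trans (Subobject.top_eq_id V).symm, fun i hi => ?_⟩
    · rw [h₁ 0 n.zero_le, Subobject.mk_eq_bot_iff_zero, h₀, Subobject.bot_arrow, zero_comp]
    · obtain hi | rfl := Nat.lt_succ_iff_lt_or_eq.mp hi
      · rw [h₁ i hi.le, h₁ (i + 1) hi]
        obtain ⟨h, hb⟩ := hF i hi
        obtain ⟨h', ⟨e⟩⟩ := exists_cokernel_ofLE_mk_iso ((F i).arrow ≫ f) ((F (i + 1)).arrow ≫ f)
          (Subobject.ofLE _ _ h) (by rw [Subobject.ofLE_arrow_assoc])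
        exact ⟨h', hb.of_iso e.symm⟩
      · rw [h₁ i le_rfl, h₂]
        obtain ⟨h', ⟨e⟩⟩ := exists_cokernel_ofLE_mk_iso ((F i).arrow ≫ f) (𝟙 V)
          ((F i).arrow ≫ f) (Category.comp_id _)
        have : IsIso (F i).arrow := (Subobject.isIso_arrow_iff_eq_top _).mpr hn
        exact ⟨h', hB.of_iso (e ≪≫ cokernelEpiComp (F i).arrow f).symm⟩

/-- The filtrations of a `♯`-filtered module can be built step by step, without reference to the
lattice of subobjects. -/
theorem isSharpFiltered_iff (V : FIGMod k G) : V.IsSharpFiltered ↔ ∃ N, HasFilt (N + 1) V := by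
  constructor
  · rintro ⟨N, F, h₀, hN, hF⟩
    have key (i : ℕ) (hi : i ≤ N + 1) : HasFilt i (F i : FIGMod k G) := by
      induction i with
      | zero =>
        rw [h₀]
        exact IsZero.of_iso (isZero_zero _) Subobject.botCoeIsoZero
      | succ i ih =>
        obtain ⟨h, W, e⟩ := hF i (by omega)
        exact ⟨_, Subobject.ofLE (F i) (F (i + 1)) h, inferInstance, ih (by omega), W, e⟩
    have : IsIso (F (N + 1)).arrow := (Subobject.isIso_arrow_iff_eq_top _).mpr hN
    exact ⟨N, (key (N + 1) le_rfl).of_iso (asIso (F (N + 1)).arrow)⟩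
  · rintro ⟨N, h⟩
    obtain ⟨F, h₀, hN, hF⟩ := h.exists_subobject
    exact ⟨N, F, h₀, hN, fun i hi => hF i (Nat.lt_succ_of_le hi)⟩

/-! ### Sharp filtrations under the three functors -/

theorem HasFilt.shift {n : ℕ} {V : FIGMod k G} (h : HasFilt n V) :
    HasFilt n ((shift k G).obj V) := by
  induction n generalizing V with
  | zero => exact (FIGMod.shift k G).map_isZero h
  | succ n ih =>
    obtain ⟨A, B, f, g, w, hS, hA, W, ⟨e⟩⟩ := h.exists_shortExact
    have hS' := hS.map_of_exact (FIGMod.shift k G)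
    cases n with
    | zero =>
      exact HasFilt.of_shortExact hS' (ih hA)
        ⟨W, ⟨(FIGMod.shift k G).mapIso e ≪≫ shiftBasicZeroIso W⟩⟩
    | succ n =>
      exact HasFilt.of_shortExact_biprod hS' (ih hA)
        ((FIGMod.shift k G).mapIso e ≪≫ shiftBasicSuccIso n W ≪≫ biprod.braiding _ _)
        ⟨_, ⟨Iso.refl _⟩⟩ ⟨_, ⟨Iso.refl _⟩⟩

theorem HasFilt.ind {n : ℕ} {V : FIGMod k G} (h : HasFilt n V) :
    HasFilt (n + 1) ((ind k G).obj V) := by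
  induction n generalizing V with
  | zero => exact HasFilt.succ (n := 0) ((FIGMod.ind k G).map_isZero h)
  | succ n ih =>
    obtain ⟨A, B, f, g, w, hS, hA, W, ⟨e⟩⟩ := h.exists_shortExact
    exact HasFilt.of_shortExact (hS.map_of_exact (FIGMod.ind k G)) (ih hA)
      ⟨_, ⟨(FIGMod.ind k G).mapIso e ≪≫ indBasicIso n W⟩⟩

theorem HasFilt.coind [Finite G] {n : ℕ} {V : FIGMod k G} (h : HasFilt n V) :
    HasFilt (n + 1) ((coind k G).obj V) := by
  induction n generalizing V with
  | zero => exact HasFilt.succ (n := 0) ((FIGMod.coind k G).map_isZero h)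
  | succ n ih =>
    obtain ⟨A, B, f, g, w, hS, hA, W, ⟨e⟩⟩ := h.exists_shortExact
    exact HasFilt.of_shortExact_biprod (hS.map_of_exact (FIGMod.coind k G)) (ih hA)
      ((FIGMod.coind k G).mapIso e ≪≫ coindBasicIso n W) ⟨_, ⟨Iso.refl _⟩⟩ ⟨_, ⟨Iso.refl _⟩⟩

end FIGMod

end

theorem theoremA (k G : Type u) [CommRing k] [IsNoetherianRing k] [Group G] [Finite G] :
    -- the three functors are adjoint
    (Nonempty (FIGMod.ind k G ⊣ FIGMod.shift k G) ∧
      Nonempty (FIGMod.shift k G ⊣ FIGMod.coind k G)) ∧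
    -- exactness
    ((PreservesFiniteLimits (FIGMod.shift k G) ∧ PreservesFiniteColimits (FIGMod.shift k G)) ∧
      (PreservesFiniteLimits (FIGMod.ind k G) ∧ PreservesFiniteColimits (FIGMod.ind k G)) ∧
      (PreservesFiniteLimits (FIGMod.coind k G) ∧ PreservesFiniteColimits (FIGMod.coind k G))) ∧
    -- preservation of sharp-filtered modules
    (∀ V : FIGMod k G, V.IsSharpFiltered →
      ((FIGMod.shift k G).obj V).IsSharpFiltered ∧
      ((FIGMod.ind k G).obj V).IsSharpFiltered ∧
      ((FIGMod.coind k G).obj V).IsSharpFiltered) ∧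
    -- the shift of a basic filtered module, in positive degree and in degree zero
    (∀ (n : ℕ) (W : Rep.{u} k (FIG.Grp G (n + 1))),
      Nonempty ((FIGMod.shift k G).obj (FIGMod.basic (n + 1) W) ≅
        FIGMod.basic (n + 1) W ⊞ FIGMod.basic n (Rep.res (FIG.grpPlus G n) W))) ∧
    (∀ W : Rep.{u} k (FIG.Grp G 0),
      Nonempty ((FIGMod.shift k G).obj (FIGMod.basic 0 W) ≅ FIGMod.basic 0 W)) ∧
    -- coinduction and induction of a basic filtered module
    (∀ (n : ℕ) (W : Rep.{u} k (FIG.Grp G n)),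
      Nonempty ((FIGMod.coind k G).obj (FIGMod.basic n W) ≅
        FIGMod.basic n W ⊞ FIGMod.basic (n + 1) (Rep.ind (FIG.grpPlus G n) W)) ∧
      Nonempty ((FIGMod.ind k G).obj (FIGMod.basic n W) ≅
        FIGMod.basic (n + 1) (Rep.ind (FIG.grpPlus G n) W))) ∧
    -- Eckmann-Shapiro
    (∀ (V V' : FIGMod k G) (i : ℕ),
      Nonempty (Abelian.Ext ((FIGMod.ind k G).obj V) V' i ≃ₗ[k]
        Abelian.Ext V ((FIGMod.shift k G).obj V') i) ∧
      Nonempty (Abelian.Ext ((FIGMod.shift k G).obj V) V' i ≃ₗ[k]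
        Abelian.Ext V ((FIGMod.coind k G).obj V') i)) := by
  refine ⟨⟨⟨FIGMod.indShiftAdj k G⟩, ⟨FIGMod.shiftCoindAdj k G⟩⟩,
    ⟨⟨inferInstance, inferInstance⟩, ⟨inferInstance, inferInstance⟩,
      ⟨inferInstance, inferInstance⟩⟩, fun V hV => ?_,
    fun n W => ⟨FIGMod.shiftBasicSuccIso n W⟩, fun W => ⟨FIGMod.shiftBasicZeroIso W⟩,
    fun n W => ⟨⟨FIGMod.coindBasicIso n W⟩, ⟨FIGMod.indBasicIso n W⟩⟩,
    fun V V' i => ⟨(FIGMod.indShiftAdj k G).nonempty_ext_linearEquiv k V V' i,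
      (FIGMod.shiftCoindAdj k G).nonempty_ext_linearEquiv k V V' i⟩⟩
  simp only [FIGMod.isSharpFiltered_iff] at hV ⊢
  obtain ⟨N, hN⟩ := hV
  exact ⟨⟨N, hN.shift⟩, ⟨N + 1, hN.ind⟩, ⟨N + 1, hN.coind⟩⟩
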